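/- Let $L>0$, $\Omega=[0,L]^3$ with periodic boundary conditions, $\lambda_1=4\pi^2/L^2$. For an integer $s\ge 0$ let $V_s$ be the space of real, mean-zero, divergence-free vector fields $u=\sum_{K\in\mathbb Z^3\setminus\{0\}}\hat u_K e^{2\pi i K\cdot x/L}$ with $\|u\|_{V_s}^2=L^3\sum_K(2\pi|K|/L)^{2s}|\hat u_K|^2<\infty$; put $H=V_0$, $V=V_1$, $D(A)=V_2$. Let $\|\cdot\|$ and $(\cdot,\cdot)$ be the norm and inner product of $L^2(\Omega)$, so that $\|u\|_{V_1}=\|\nabla u\|$. Let $A=-\Delta$, let $\mathcal P$ be the Helmholtz–Leray projection, $B(u,v)=\mathcal P[(u\cdot\nabla)v]$, and let $P_N$ be the projection onto the Fourier modes $0<|K|<N$. Let $c$ be any constant for which the Gagliardo–Nirenberg inequalities $\|g\|_{L^3}\le c\|g\|^{1/2}\|\nabla g\|^{1/2}$, $\|g\|_{L^4}\le c\|g\|^{1/4}\|\nabla g\|^{3/4}$, $\|g\|_{L^6}\le c\|\nabla g\|$ hold for all $g\in V$. Let $\nu,\alpha,\beta_n,\eta_n>0$, $N_n\in\mathbb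 N$, $f\in L^\infty([0,\infty);H)$ and $0\le t_n\le\hat t_n<t_{n+1}$. Let $u$ be a solution on $[t_n,t_{n+1}]$ of $$\frac{dv}{dt}+\nu Av+B(u,u)=f,\qquad v=u+\alpha^2Au,$$ and $w_n$ a solution on $[t_n,t_{n+1}]$ of $$\frac{dz_n}{dt}+\nu Az_n+B(w_n,w_n)=f-\eta_n(I+\beta_n^2A)\mathcal P(P_{N_n}w_n-P_{N_n}u),\qquad z_n=w_n+\beta_n^2Aw_n.$$ Here a solution is a function in $C([t_n,t_{n+1}];V)\cap L^2(t_n,t_{n+1};D(A))$ with time derivative in $L^2(t_n,t_{n+1};H)$ for which the equation holds in the dual of $D(A)$ for almost every $t$. Put $g_n=w_n-u$, $\psi_n=P_{N_n}(u_t+\nu Au)$ and $$\delta_n=\int_{\hat t_n}^{t_{n+1}}\|\nabla P_{N_n}(u_t-\nu\Delta u)\|^2\,ds,\qquad \tilde\delta_n=\frac{\delta_n}{t_{n+1}-\hat t_n}.$$ Suppose $\delta_n>0$ and let $\beta_{n+1}^2$ denote the real number $$\begin{aligned}\beta_{n+1}^2=\beta_n^2+\frac1{\delta_n}\int_{\hat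 t_n}^{t_{n+1}}\Big[&\big(\tfrac{d}{dt}P_{N_n}g_n,\psi_n\big)+\beta_n^2\big(\tfrac{d}{dt}\nabla P_{N_n}g_n,\nabla\psi_n\big)+\nu(\nabla P_{N_n}g_n,\nabla\psi_n)+\nu\beta_n^2(\nabla AP_{N_n}g_n,\nabla\psi_n)\\&+\big(P_{N_n}B(w_n,w_n)-P_{N_n}B(w_n-P_{N_n}g_n,w_n-P_{N_n}g_n),\psi_n\big)\\&+\eta_n(P_{N_n}g_n,\psi_n)+\beta_n^2\eta_n(\nabla P_{N_n}g_n,\nabla\psi_n)\Big]ds.\end{aligned}$$ Then $$|\alpha^2-\beta_{n+1}^2|\le\frac{4c^2\lambda_1^{-1/4}}{\tilde\delta_n^{1/2}N_n^{1/2}}\sup_{\hat t_n\le s\le t_{n+1}}\big\{(\|\nabla w_n(s)\|+\|\nabla u(s)\|)\|\nabla g_n(s)\|\big\},$$ and moreover $$\begin{aligned}\alpha^2-\beta_{n+1}^2=\frac1{\delta_n}\int_{\hat t_n}^{t_{n+1}}\Big[&(P_{N_n}B(g_n-P_{N_n}g_n,w_n),\psi_n)+(P_{N_n}B(w_n,g_n-P_{N_n}g_n),\psi_n)\\&+(P_{N_n}B(P_{N_n}g_n-g_n,P_{N_n}g_n),\psi_n)+(P_{N_n}B(g_n,P_{N_n}g_n-g_n),\psi_n)\Big]ds.\end{aligned}$$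 -/

import Mathlib

noncomputable section

namespace Bardina

open MeasureTheory Filter Topology

/-- A vector field on the periodic box `[0,L]³`, given by its Fourier coefficients:
`û` stands for `x ↦ ∑_K û_K exp (2πi K·x / L)`. -/
abbrev Coeff : Type := (Fin 3 → ℤ) → EuclideanSpace ℂ (Fin 3)

/-- `|K|²`. -/
def normSq (K : Fin 3 → ℤ) : ℝ := ∑ j, (K j : ℝ) ^ 2

/-- `(2π|K|/L)² = 4π²|K|²/L²`, the eigenvalue of `A = -Δ` on the `K`-th mode. -/
def lam (L : ℝ) (K : Fin 3 → ℤ) : ℝ := 4 * Real.pi ^ 2 * normSq K / L ^ 2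

/-- `λ₁ = 4π²/L²`. -/
def lam1 (L : ℝ) : ℝ := 4 * Real.pi ^ 2 / L ^ 2

/-- The bilinear (not sesquilinear) product `a · K` of a complex vector and a wave number. -/
def dotK (a : EuclideanSpace ℂ (Fin 3)) (K : Fin 3 → ℤ) : ℂ := ∑ j, a j * (K j : ℂ)

/-- The space `V_s` of real, mean-zero, divergence-free fields with `∑ |K|^(2s) |û_K|² < ∞`.
`H = V_0`, `V = V_1`, `D(A) = V_2`. -/
def VSpace (s : ℕ) : Set Coeff :=
  {u | u 0 = 0 ∧ (∀ K j, u (-K) j = starRingEnd ℂ (u K j)) ∧ (∀ K, dotK (u K) K = 0) ∧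
    Summable fun K => normSq K ^ s * ‖u K‖ ^ 2}

/-- `‖u‖_{V_s}`; for `s = 0, 1, 2` these are `‖u‖`, `‖∇u‖`, `‖Au‖`, the norms being those of
`L²([0,L]³)`. -/
def sNorm (L : ℝ) (s : ℕ) (u : Coeff) : ℝ :=
  Real.sqrt (L ^ 3 * ∑' K, lam L K ^ s * ‖u K‖ ^ 2)

/-- `(u, v)_{V_s}`; for `s = 0, 1` these are the `L²([0,L]³)` products `(u, v)` and `(∇u, ∇v)`.
For real fields the sum without the real part is real already. -/
def sInner (L : ℝ) (s : ℕ) (u v : Coeff) : ℝ :=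
  L ^ 3 * ∑' K, lam L K ^ s * (∑ j, u K j * starRingEnd ℂ (v K j)).re

/-- The Stokes operator `A = -Δ`. -/
def stokes (L : ℝ) (u : Coeff) : Coeff := fun K => lam L K • u K

/-- The Helmholtz-Leray projection. -/
def leray (u : Coeff) : Coeff := fun K =>
  if K = 0 then 0
  else u K - (dotK (u K) K / (normSq K : ℂ)) • WithLp.toLp 2 (fun j => (K j : ℂ))

open Classical in
/-- The projection `P_N` onto the modes `0 < |K| < N`. -/
def proj (N : ℕ) (u : Coeff) : Coeff := fun K =>
  if 0 < Real.sqrt (normSq K) ∧ Real.sqrt (normSq K) < N then u K else 0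

/-- `(u·∇)v`: its `K`-th Fourier coefficient is `∑_J (û_J · (2πi/L) (K - J)) v̂_{K-J}`. -/
def advect (L : ℝ) (u v : Coeff) : Coeff := fun K =>
  ∑' J, (2 * Real.pi * Complex.I / L * dotK (u J) (K - J)) • v (K - J)

/-- `B(u,v)`, the Leray projection of `(u·∇)v`. -/
def bilin (L : ℝ) (u v : Coeff) : Coeff := leray (advect L u v)

/-- The time derivative, mode by mode. -/
def timeDeriv (u : ℝ → Coeff) (t : ℝ) : Coeff := fun K => deriv (fun s => u s K) t

/-- `f ∈ L^∞([0,∞); H)`. -/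
structure IsForcing (L : ℝ) (f : ℝ → Coeff) : Prop where
  meas : ∀ K, AEStronglyMeasurable (fun t => f t K) (volume.restrict (Set.Ici 0))
  mem : ∀ᵐ t ∂volume.restrict (Set.Ici (0 : ℝ)), f t ∈ VSpace 0
  bound : ∃ M : ℝ, ∀ᵐ t ∂volume.restrict (Set.Ici (0 : ℝ)), sNorm L 0 (f t) ≤ M

/-- The regularity class of solutions on `[a,b]`:
`u ∈ C([a,b]; V) ∩ L²(a,b; D(A))` and `u_t ∈ L²(a,b; H)`. The fields `deriv_int` and `ftc` say that
each mode is absolutely continuous, so that `timeDeriv u` is the weak time derivative `u_t`. In this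
class all the time integrals below converge. -/
structure IsRegular (L a b : ℝ) (u : ℝ → Coeff) : Prop where
  mem_V : ∀ t ∈ Set.Icc a b, u t ∈ VSpace 1
  cont_V : ∀ t ∈ Set.Icc a b,
    Tendsto (fun s => sNorm L 1 (u s - u t)) (𝓝[Set.Icc a b] t) (𝓝 0)
  mem_DA : ∀ᵐ t ∂volume.restrict (Set.Icc a b), u t ∈ VSpace 2
  sq_int_DA : IntegrableOn (fun t => sNorm L 2 (u t) ^ 2) (Set.Icc a b)
  deriv_int : ∀ K, IntervalIntegrable (fun t => timeDeriv u t K) volume a b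
  ftc : ∀ K, ∀ t ∈ Set.Icc a b, u t K = u a K + ∫ s in a..t, timeDeriv u s K
  deriv_mem_H : ∀ᵐ t ∂volume.restrict (Set.Icc a b), timeDeriv u t ∈ VSpace 0
  sq_int_deriv : IntegrableOn (fun t => sNorm L 0 (timeDeriv u t) ^ 2) (Set.Icc a b)

/-- The filtered-to-unfiltered map `(I + α²A) u`. -/
def helm (L α : ℝ) (u : Coeff) : Coeff := u + α ^ 2 • stokes L u

/-- `u` solves `dv/dt + νAv + B(u,u) = f`, `v = u + α²Au`, on `[a,b]`. The equation is an equality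
in the dual of `D(A)`, that is, an equality of Fourier coefficients, at almost every time. -/
structure IsBardinaSolution (L ν α : ℝ) (f : ℝ → Coeff) (a b : ℝ) (u : ℝ → Coeff) : Prop where
  regular : IsRegular L a b u
  eqn : ∀ᵐ t ∂volume.restrict (Set.Icc a b),
    timeDeriv (fun s => helm L α (u s)) t + ν • stokes L (helm L α (u t))
      + bilin L (u t) (u t) = f t

/-- `w` solves the nudged system `dz/dt + νAz + B(w,w) = f - η(I + β²A)𝒫(P_N w - P_N u)`,
`z = w + β²Aw`, on `[a,b]`, where `𝒫` is the Leray projection. -/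
structure IsNudgedSolution (L ν β η : ℝ) (N : ℕ) (f u : ℝ → Coeff) (a b : ℝ)
    (w : ℝ → Coeff) : Prop where
  regular : IsRegular L a b w
  eqn : ∀ᵐ t ∂volume.restrict (Set.Icc a b),
    timeDeriv (fun s => helm L β (w s)) t + ν • stokes L (helm L β (w t))
      + bilin L (w t) (w t)
      = f t - η • helm L β (leray (proj N (w t) - proj N (u t)))

/-- `P_N (u_t + νAu)` at time `t`. -/
def resid (L ν : ℝ) (N : ℕ) (u : ℝ → Coeff) (t : ℝ) : Coeff :=
  proj N (timeDeriv u t + ν • stokes L (u t))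

/-- `δ = ∫_τ^T ‖∇P_N(u_t - νΔu)‖² ds` (recall `A = -Δ`). -/
def delta (L ν : ℝ) (N : ℕ) (u : ℝ → Coeff) (τ T : ℝ) : ℝ :=
  ∫ s in τ..T, sNorm L 1 (resid L ν N u s) ^ 2

/-- The value that the recovery algorithm assigns to the square of the next parameter; `β` is the
current parameter and `g = w - u`. -/
def updatedBetaSq (L ν β η : ℝ) (N : ℕ) (u w : ℝ → Coeff) (τ T : ℝ) : ℝ :=
  let g : ℝ → Coeff := fun s => w s - u s
  let Pg : ℝ → Coeff := fun s => proj N (g s)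
  let r : ℝ → Coeff := resid L ν N u
  β ^ 2 + 1 / delta L ν N u τ T * ∫ s in τ..T,
    (sInner L 0 (timeDeriv Pg s) (r s)
      + β ^ 2 * sInner L 1 (timeDeriv Pg s) (r s)
      + ν * sInner L 1 (Pg s) (r s)
      + ν * β ^ 2 * sInner L 1 (stokes L (Pg s)) (r s)
      + sInner L 0 (proj N (bilin L (w s) (w s))
          - proj N (bilin L (w s - Pg s) (w s - Pg s))) (r s)
      + η * sInner L 0 (Pg s) (r s)
      + β ^ 2 * η * sInner L 1 (Pg s) (r s))

/-- The probability Haar measure of the unit torus (the one used for its Fourier coefficients). -/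
def torusMeasure : Measure (UnitAddTorus (Fin 3)) := Measure.pi fun _ => AddCircle.haarAddCircle

/-- Fourier coefficients of a real vector field on the torus. The box `[0,L]³` is parametrised by
the unit torus through `x = L y`, so `G y` stands for the value of the field at `L y`. -/
def fieldCoeff (G : UnitAddTorus (Fin 3) → EuclideanSpace ℝ (Fin 3)) : Coeff := fun K =>
  WithLp.toLp 2 fun j => UnitAddTorus.mFourierCoeff (fun y => ((G y j : ℝ) : ℂ)) K

/-- The norm of `L^p([0,L]³)` of the field `x ↦ G (x / L)`; the change of variables `x = L y` gives
the factor `L^(3/p)`. -/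
def boxLpNorm (L : ℝ) (p : ℕ) (G : UnitAddTorus (Fin 3) → EuclideanSpace ℝ (Fin 3)) : ENNReal :=
  ENNReal.ofReal (L ^ ((3 : ℝ) / p)) * eLpNorm G p torusMeasure

/-- `c` is a constant for which, on the box `[0,L]³` and for every `g ∈ V`,
`‖g‖_{L³} ≤ c ‖g‖^(1/2) ‖∇g‖^(1/2)`, `‖g‖_{L⁴} ≤ c ‖g‖^(1/4) ‖∇g‖^(3/4)` and
`‖g‖_{L⁶} ≤ c ‖∇g‖`. -/
def IsGagliardoNirenbergConst (L c : ℝ) : Prop :=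
  ∀ G : UnitAddTorus (Fin 3) → EuclideanSpace ℝ (Fin 3), MemLp G 2 torusMeasure →
    fieldCoeff G ∈ VSpace 1 →
    boxLpNorm L 3 G ≤ ENNReal.ofReal
        (c * sNorm L 0 (fieldCoeff G) ^ (1 / 2 : ℝ) * sNorm L 1 (fieldCoeff G) ^ (1 / 2 : ℝ)) ∧
    boxLpNorm L 4 G ≤ ENNReal.ofReal
        (c * sNorm L 0 (fieldCoeff G) ^ (1 / 4 : ℝ) * sNorm L 1 (fieldCoeff G) ^ (3 / 4 : ℝ)) ∧
    boxLpNorm L 6 G ≤ ENNReal.ofReal (c * sNorm L 1 (fieldCoeff G))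

end Bardina

end

open Bardina

/-!
Put `g = w - u` and `r = P_N (u_t + νAu)`. Apply `P_N` to the difference of the two equations: the
unknown parameter enters the result only through `(α² - β²) A r`, so pairing with `r` turns it into
`(α² - β²) ‖∇r‖²`. The update adds to `β²` the time average of that balance with the unobservable
nonlinearity `B(u, u)` replaced by `B(w - P_N g, w - P_N g)`, and the error of the update is the
pairing with `r` of what this replacement leaves over. By bilinearity it is a sum of four terms,
each containing the high-frequency part `q = g - P_N g`. Hölder's inequality with exponents
`(3, 2, 6)`, the derivative being moved onto `r` when it falls on `q`, bounds each of them by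
`c² ‖q‖^(1/2) ‖∇q‖^(1/2)` times two gradient norms, and `‖q‖ ≤ λ₁^(-1/2) N⁻¹ ‖∇q‖` yields the decay
in `N`. The Cauchy–Schwarz inequality in time concludes.
-/

noncomputable section

namespace Bardina

open MeasureTheory Filter Topology
open UnitAddTorus (mFourier mFourierCoeff)
open scoped ComplexConjugate

/-! ### Wave numbers -/

section WaveNumber

variable (L : ℝ) (a b : EuclideanSpace ℂ (Fin 3)) (K : Fin 3 → ℤ)

lemma normSq_nonneg : 0 ≤ normSq K := Finset.sum_nonneg fun _ _ => sq_nonneg _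

lemma normSq_neg : normSq (-K) = normSq K := by simp [normSq]

lemma normSq_zero : normSq 0 = 0 := by simp [normSq]

lemma sq_apply_le_normSq (j : Fin 3) : (K j : ℝ) ^ 2 ≤ normSq K :=
  Finset.single_le_sum (f := fun j => (K j : ℝ) ^ 2) (fun _ _ => sq_nonneg _) (Finset.mem_univ j)

variable {K} in
lemma one_le_normSq (hK : K ≠ 0) : 1 ≤ normSq K := by
  obtain ⟨j, hj⟩ := Function.ne_iff.1 hK
  have hj' : (1 : ℝ) ≤ (K j : ℝ) ^ 2 := by
    exact_mod_cast (pow_pos (abs_pos.2 hj) 2).trans_eq (sq_abs _)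
  exact hj'.trans (sq_apply_le_normSq K j)

lemma lam_eq : lam L K = lam1 L * normSq K := by
  simp only [lam, lam1]; ring

lemma lam1_nonneg : 0 ≤ lam1 L := by
  unfold lam1; positivity

variable {L} in
lemma lam1_pos (hL : 0 < L) : 0 < lam1 L := by
  unfold lam1; positivity

lemma lam_nonneg : 0 ≤ lam L K :=
  lam_eq L K ▸ mul_nonneg (lam1_nonneg L) (normSq_nonneg K)

/-- The wave number `K` as a complex vector; `dotK a K` is its inner product with `a`. -/
def waveVec : EuclideanSpace ℂ (Fin 3) := WithLp.toLp 2 fun j => (K j : ℂ)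

lemma norm_waveVec_sq : ‖waveVec K‖ ^ 2 = normSq K := by
  simp [waveVec, EuclideanSpace.norm_sq_eq, normSq]

lemma dotK_eq_inner : dotK a K = inner ℂ (waveVec K) a := by
  simp [dotK, waveVec, PiLp.inner_apply]

lemma norm_dotK_le : ‖dotK a K‖ ≤ ‖waveVec K‖ * ‖a‖ := by
  rw [dotK_eq_inner]; exact norm_inner_le_norm _ _

lemma dotK_zero : dotK 0 K = 0 := by simp [dotK]

lemma dotK_add : dotK (a + b) K = dotK a K + dotK b K := by simp [dotK_eq_inner]

lemma dotK_sub : dotK (a - b) K = dotK a K - dotK b K := by simp [dotK_eq_inner]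

lemma dotK_real_smul (c : ℝ) : dotK (c • a) K = c * dotK a K := by
  simp [dotK, Finset.mul_sum, mul_assoc]

end WaveNumber

/-! ### The spaces `V_s` -/

/-- The coefficients `|K|^s û_K`: their `ℓ²` norm is the norm of `V_s` up to a constant factor. -/
def weighted (s : ℕ) : Coeff →ₗ[ℝ] Coeff :=
  LinearMap.pi fun K => √(normSq K ^ s) • LinearMap.proj K

lemma norm_weighted_sq (s : ℕ) (u : Coeff) (K : Fin 3 → ℤ) :
    ‖weighted s u K‖ ^ 2 = normSq K ^ s * ‖u K‖ ^ 2 := by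
  change ‖√(normSq K ^ s) • u K‖ ^ 2 = _
  rw [norm_smul, mul_pow, Real.norm_eq_abs, sq_abs,
    Real.sq_sqrt (pow_nonneg (normSq_nonneg K) s)]

lemma memℓp_weighted_iff {s : ℕ} {u : Coeff} :
    Memℓp (weighted s u) 2 ↔ Summable fun K => normSq K ^ s * ‖u K‖ ^ 2 := by
  rw [memℓp_gen_iff (by norm_num)]
  simp [norm_weighted_sq]

namespace VSpace

variable {s : ℕ} {u : Coeff}

lemma memℓp_weighted (hu : u ∈ VSpace s) : Memℓp (weighted s u) 2 :=
  memℓp_weighted_iff.2 hu.2.2.2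

/-- `V_s` as a vector space. -/
def submodule (s : ℕ) : Submodule ℝ Coeff where
  carrier := VSpace s
  zero_mem' := ⟨rfl, by simp, fun K => dotK_zero K, by simp [summable_zero]⟩
  add_mem' {u v} hu hv :=
    ⟨by simp [hu.1, hv.1], fun K j => by simp [hu.2.1 K j, hv.2.1 K j],
      fun K => by simp [dotK_add, hu.2.2.1 K, hv.2.2.1 K], memℓp_weighted_iff.1 <| by
        rw [map_add]; exact (memℓp_weighted hu).add (memℓp_weighted hv)⟩
  smul_mem' c u hu :=
    ⟨by simp [hu.1], fun K j => by simp [hu.2.1 K j],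
      fun K => by simp [dotK_real_smul, hu.2.2.1 K], memℓp_weighted_iff.1 <| by
        rw [map_smul]; exact (memℓp_weighted hu).const_smul c⟩

lemma add {v : Coeff} (hu : u ∈ VSpace s) (hv : v ∈ VSpace s) : u + v ∈ VSpace s :=
  (submodule s).add_mem hu hv

lemma sub {v : Coeff} (hu : u ∈ VSpace s) (hv : v ∈ VSpace s) : u - v ∈ VSpace s :=
  (submodule s).sub_mem hu hv

lemma real_smul (c : ℝ) (hu : u ∈ VSpace s) : c • u ∈ VSpace s :=
  (submodule s).smul_mem c hu

lemma summable_lam (L : ℝ) (hu : u ∈ VSpace s) : Summable fun K => lam L K ^ s * ‖u K‖ ^ 2 := by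
  simpa only [lam_eq, mul_pow, mul_assoc] using hu.2.2.2.mul_left (lam1 L ^ s)

lemma mono {s' : ℕ} (hs : s' ≤ s) (hu : u ∈ VSpace s) : u ∈ VSpace s' := by
  refine ⟨hu.1, hu.2.1, hu.2.2.1, hu.2.2.2.of_nonneg_of_le (fun K => ?_) (fun K => ?_)⟩
  · exact mul_nonneg (pow_nonneg (normSq_nonneg K) _) (sq_nonneg _)
  by_cases hK : K = 0
  · simp [hK, hu.1]
  · gcongr
    exact one_le_normSq hK

lemma summable_norm_sq (hu : u ∈ VSpace s) : Summable fun K => ‖u K‖ ^ 2 := by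
  simpa using (mono (Nat.zero_le s) hu).2.2.2

lemma stokes (L : ℝ) (hu : u ∈ VSpace (s + 2)) : stokes L u ∈ VSpace s := by
  refine ⟨by simp [Bardina.stokes, hu.1], fun K j => ?_, fun K => ?_, ?_⟩
  · simp [Bardina.stokes, lam_eq, normSq_neg, hu.2.1 K j]
  · simp [Bardina.stokes, dotK_real_smul, hu.2.2.1 K]
  · refine (hu.2.2.2.mul_left (lam1 L ^ 2)).congr fun K => ?_
    simp only [Bardina.stokes, norm_smul, mul_pow, Real.norm_eq_abs, sq_abs, lam_eq]
    ring

end VSpace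

section SNorm

variable {L : ℝ} {s : ℕ} {u v : Coeff}

lemma sNorm_nonneg (L : ℝ) (s : ℕ) (u : Coeff) : 0 ≤ sNorm L s u := Real.sqrt_nonneg _

lemma sNorm_sq (hL : 0 < L) (s : ℕ) (u : Coeff) :
    sNorm L s u ^ 2 = L ^ 3 * ∑' K, lam L K ^ s * ‖u K‖ ^ 2 :=
  Real.sq_sqrt (mul_nonneg (by positivity)
    (tsum_nonneg fun K => mul_nonneg (pow_nonneg (lam_nonneg L K) _) (sq_nonneg _)))

lemma sNorm_eq_norm (L : ℝ) (hu : Memℓp (weighted s u) 2) :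
    sNorm L s u = √(L ^ 3 * lam1 L ^ s)
      * ‖(⟨weighted s u, hu⟩ : lp (fun _ : Fin 3 → ℤ => EuclideanSpace ℂ (Fin 3)) 2)‖ := by
  rw [lp.norm_eq_tsum_rpow (by norm_num)]
  simp only [ENNReal.toReal_ofNat, Real.rpow_two, norm_weighted_sq, ← Real.sqrt_eq_rpow]
  rw [← Real.sqrt_mul' _ (tsum_nonneg fun K =>
    mul_nonneg (pow_nonneg (normSq_nonneg K) _) (sq_nonneg _)), mul_assoc, ← tsum_mul_left]
  simp only [sNorm, lam_eq, mul_pow, mul_assoc]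

lemma sNorm_neg (L : ℝ) (s : ℕ) (u : Coeff) : sNorm L s (-u) = sNorm L s u := by simp [sNorm]

lemma sNorm_sub_comm (L : ℝ) (s : ℕ) (u v : Coeff) : sNorm L s (u - v) = sNorm L s (v - u) := by
  rw [← neg_sub, sNorm_neg]

lemma sNorm_sub_le (L : ℝ) (hu : u ∈ VSpace s) (hv : v ∈ VSpace s) :
    sNorm L s (u - v) ≤ sNorm L s u + sNorm L s v := by
  rw [sNorm_eq_norm L (VSpace.memℓp_weighted hu), sNorm_eq_norm L (VSpace.memℓp_weighted hv),
    sNorm_eq_norm L (VSpace.memℓp_weighted (VSpace.sub hu hv)), ← mul_add]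
  simp only [map_sub]
  gcongr
  exact norm_sub_le (E := lp (fun _ : Fin 3 → ℤ => EuclideanSpace ℂ (Fin 3)) 2)
    ⟨_, VSpace.memℓp_weighted hu⟩ ⟨_, VSpace.memℓp_weighted hv⟩

lemma abs_sNorm_sub_sNorm_le (L : ℝ) (hu : u ∈ VSpace s) (hv : v ∈ VSpace s) :
    |sNorm L s u - sNorm L s v| ≤ sNorm L s (u - v) := by
  rw [sNorm_eq_norm L (VSpace.memℓp_weighted hu), sNorm_eq_norm L (VSpace.memℓp_weighted hv),
    sNorm_eq_norm L (VSpace.memℓp_weighted (VSpace.sub hu hv)), ← mul_sub, abs_mul,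
    abs_of_nonneg (Real.sqrt_nonneg _)]
  simp only [map_sub]
  gcongr
  exact abs_norm_sub_norm_le (E := lp (fun _ : Fin 3 → ℤ => EuclideanSpace ℂ (Fin 3)) 2)
    ⟨_, VSpace.memℓp_weighted hu⟩ ⟨_, VSpace.memℓp_weighted hv⟩

lemma sNorm_mono (hL : 0 < L) (hu : u ∈ VSpace s) (h : ∀ K, ‖v K‖ ≤ ‖u K‖) :
    sNorm L s v ≤ sNorm L s u := by
  have hle : ∀ K, lam L K ^ s * ‖v K‖ ^ 2 ≤ lam L K ^ s * ‖u K‖ ^ 2 := fun K => by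
    have := lam_nonneg L K
    gcongr
    exact h K
  have hv := (VSpace.summable_lam L hu).of_nonneg_of_le
    (fun K => mul_nonneg (pow_nonneg (lam_nonneg L K) _) (sq_nonneg _)) hle
  exact Real.sqrt_le_sqrt (mul_le_mul_of_nonneg_left
    (hv.tsum_le_tsum hle (VSpace.summable_lam L hu)) (by positivity))

/-- Poincaré's inequality for fields without modes below `|K|² = m`. -/
lemma sqrt_mul_sNorm_le_sNorm_succ (hL : 0 < L) {m : ℝ} (hu : u ∈ VSpace (s + 1))
    (hm : ∀ K, u K ≠ 0 → m ≤ normSq K) :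
    √(lam1 L * m) * sNorm L s u ≤ sNorm L (s + 1) u := by
  have hle : ∀ K, lam1 L * m * (lam L K ^ s * ‖u K‖ ^ 2) ≤ lam L K ^ (s + 1) * ‖u K‖ ^ 2 := by
    intro K
    by_cases hK : u K = 0
    · simp [hK]
    calc lam1 L * m * (lam L K ^ s * ‖u K‖ ^ 2)
        ≤ lam L K * (lam L K ^ s * ‖u K‖ ^ 2) := by
          have := lam_nonneg L K
          gcongr
          rw [lam_eq]
          exact mul_le_mul_of_nonneg_left (hm K hK) (lam1_nonneg L)
      _ = lam L K ^ (s + 1) * ‖u K‖ ^ 2 := by ring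
  have hs := VSpace.summable_lam L (VSpace.mono (Nat.le_succ s) hu)
  rw [sNorm, sNorm, ← Real.sqrt_mul' _ (mul_nonneg (by positivity) (tsum_nonneg fun K =>
    mul_nonneg (pow_nonneg (lam_nonneg L K) _) (sq_nonneg _))), mul_left_comm, ← tsum_mul_left]
  exact Real.sqrt_le_sqrt (mul_le_mul_of_nonneg_left
    ((hs.mul_left _).tsum_le_tsum hle (VSpace.summable_lam L hu)) (by positivity))

end SNorm

/-! ### Low-mode projections and inner products -/

open Classical in
/-- The wave numbers `0 < |K| < N`. -/
def lowModes (N : ℕ) : Finset (Fin 3 → ℤ) :=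
  {K ∈ Finset.Icc (fun _ => -(N : ℤ)) (fun _ => (N : ℤ)) | K ≠ 0 ∧ normSq K < (N : ℝ) ^ 2}

section Proj

variable {N : ℕ} {K : Fin 3 → ℤ}

lemma mem_lowModes : K ∈ lowModes N ↔ K ≠ 0 ∧ normSq K < (N : ℝ) ^ 2 := by
  simp only [lowModes, Finset.mem_filter, Finset.mem_Icc, and_iff_right_iff_imp]
  rintro ⟨-, hK⟩
  have hle : ∀ j, |K j| ≤ (N : ℤ) := fun j => by
    exact_mod_cast abs_le_of_sq_le_sq ((sq_apply_le_normSq K j).trans hK.le) N.cast_nonneg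
  exact ⟨fun j => (abs_le.1 (hle j)).1, fun j => (abs_le.1 (hle j)).2⟩

lemma mem_lowModes_iff_sqrt : K ∈ lowModes N ↔ 0 < √(normSq K) ∧ √(normSq K) < N := by
  rw [mem_lowModes, Real.sqrt_pos, ← Real.sqrt_sq (Nat.cast_nonneg (α := ℝ) N),
    Real.sqrt_lt_sqrt_iff (normSq_nonneg K), Real.sqrt_sq N.cast_nonneg]
  refine and_congr_left fun _ => ⟨fun hK => one_pos.trans_le (one_le_normSq hK), ?_⟩
  rintro h rfl
  exact h.ne' normSq_zero

lemma proj_apply_of_mem (hK : K ∈ lowModes N) (u : Coeff) : proj N u K = u K :=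
  if_pos (mem_lowModes_iff_sqrt.1 hK)

lemma proj_apply_of_notMem (hK : K ∉ lowModes N) (u : Coeff) : proj N u K = 0 :=
  if_neg fun h => hK (mem_lowModes_iff_sqrt.2 h)

variable (N) in
lemma norm_sub_proj_le (u : Coeff) (K : Fin 3 → ℤ) : ‖(u - proj N u) K‖ ≤ ‖u K‖ := by
  by_cases hK : K ∈ lowModes N <;> simp [proj_apply_of_mem, proj_apply_of_notMem, hK]

variable (N) in
lemma norm_proj_le (u : Coeff) (K : Fin 3 → ℤ) : ‖proj N u K‖ ≤ ‖u K‖ := by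
  by_cases hK : K ∈ lowModes N <;> simp [proj_apply_of_mem, proj_apply_of_notMem, hK]

lemma VSpace.proj (N : ℕ) {s s' : ℕ} {u : Coeff} (hu : u ∈ VSpace s) : proj N u ∈ VSpace s' := by
  have hneg : ∀ K, -K ∈ lowModes N ↔ K ∈ lowModes N := fun K => by
    simp only [mem_lowModes, neg_ne_zero, normSq_neg]
  refine ⟨proj_apply_of_notMem (by simp [mem_lowModes]) u, fun K j => ?_, fun K => ?_,
    summable_of_ne_finset_zero (s := lowModes N) fun K hK => by simp [proj_apply_of_notMem hK]⟩
  · by_cases hK : K ∈ lowModes N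
    · rw [proj_apply_of_mem hK, proj_apply_of_mem ((hneg K).2 hK), hu.2.1]
    · simp [proj_apply_of_notMem hK, proj_apply_of_notMem (mt (hneg K).1 hK)]
  · by_cases hK : K ∈ lowModes N
    · rw [proj_apply_of_mem hK, hu.2.2.1]
    · rw [proj_apply_of_notMem hK, dotK_zero]

/-- The gain `N^(-1/2)` in the final estimate: `g - P_N g` has only modes with `|K| ≥ N`. -/
lemma interpolation_sub_proj_le {L : ℝ} (hL : 0 < L) (hN : 0 < N) {g : Coeff}
    (hg : g ∈ VSpace 1) :
    sNorm L 0 (g - proj N g) ^ (1 / 2 : ℝ) * sNorm L 1 (g - proj N g) ^ (1 / 2 : ℝ)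
      ≤ lam1 L ^ (-(1 / 4) : ℝ) / (N : ℝ) ^ (1 / 2 : ℝ) * sNorm L 1 g := by
  set q := g - proj N g
  have hl := lam1_pos hL
  have hN' : (0 : ℝ) < N := by exact_mod_cast hN
  have hm : ∀ K, q K ≠ 0 → (N : ℝ) ^ 2 ≤ normSq K := fun K hK => by
    by_contra! hlt
    refine hK (sub_eq_zero.2 (proj_apply_of_mem (mem_lowModes.2 ⟨?_, hlt⟩) g).symm)
    rintro rfl
    exact hK (VSpace.sub hg (VSpace.proj N hg)).1
  have hpoincare := sqrt_mul_sNorm_le_sNorm_succ hL (VSpace.sub hg (VSpace.proj N hg)) hm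
  rw [Real.sqrt_mul hl.le, Real.sqrt_sq hN'.le, ← le_div_iff₀' (by positivity)] at hpoincare
  have hq0 := sNorm_nonneg L 0 q
  have hq1 := sNorm_nonneg L 1 q
  calc sNorm L 0 q ^ (1 / 2 : ℝ) * sNorm L 1 q ^ (1 / 2 : ℝ)
      ≤ (sNorm L 1 q / (√(lam1 L) * N)) ^ (1 / 2 : ℝ) * sNorm L 1 q ^ (1 / 2 : ℝ) := by gcongr
    _ = lam1 L ^ (-(1 / 4) : ℝ) / (N : ℝ) ^ (1 / 2 : ℝ) * sNorm L 1 q := by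
      rw [Real.div_rpow hq1 (by positivity), Real.mul_rpow (by positivity) hN'.le,
        Real.sqrt_eq_rpow, ← Real.rpow_mul hl.le, Real.rpow_neg hl.le, div_mul_eq_mul_div,
        ← Real.sqrt_eq_rpow (sNorm L 1 q), Real.mul_self_sqrt hq1]
      norm_num
      ring
    _ ≤ _ := by
      gcongr
      exact sNorm_mono hL hg (norm_sub_proj_le N g)

end Proj

section SInner

variable {S : Finset (Fin 3 → ℤ)} {N s : ℕ} {r : Coeff}

lemma sInner_eq_sum (hS : ∀ K ∉ S, r K = 0) (L : ℝ) (s : ℕ) (X : Coeff) :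
    sInner L s X r = L ^ 3 * ∑ K ∈ S, lam L K ^ s * (inner ℂ (r K) (X K)).re := by
  rw [sInner, tsum_eq_sum (s := S) fun K hK => by simp [hS K hK]]
  simp only [PiLp.inner_apply, RCLike.inner_apply]

lemma sInner_add_left (hS : ∀ K ∉ S, r K = 0) (L : ℝ) (s : ℕ) (X Y : Coeff) :
    sInner L s (X + Y) r = sInner L s X r + sInner L s Y r := by
  simp only [sInner_eq_sum hS, Pi.add_apply, inner_add_right, Complex.add_re, mul_add,
    Finset.sum_add_distrib]

lemma sInner_sub_left (hS : ∀ K ∉ S, r K = 0) (L : ℝ) (s : ℕ) (X Y : Coeff) :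
    sInner L s (X - Y) r = sInner L s X r - sInner L s Y r := by
  simp only [sInner_eq_sum hS, Pi.sub_apply, inner_sub_right, Complex.sub_re, mul_sub,
    Finset.sum_sub_distrib]

lemma sInner_smul_left (hS : ∀ K ∉ S, r K = 0) (L : ℝ) (s : ℕ) (c : ℝ) (X : Coeff) :
    sInner L s (c • X) r = c * sInner L s X r := by
  simp only [sInner_eq_sum hS, Pi.smul_apply, inner_smul_right_eq_smul, Complex.smul_re,
    smul_eq_mul, Finset.mul_sum]
  exact Finset.sum_congr rfl fun K _ => by ring

lemma sInner_stokes_left (L : ℝ) (s : ℕ) (X r : Coeff) :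
    sInner L s (stokes L X) r = sInner L (s + 1) X r := by
  simp only [sInner, stokes, PiLp.smul_apply, smul_mul_assoc, ← Finset.smul_sum, Complex.smul_re,
    smul_eq_mul, pow_succ, mul_assoc]

lemma sInner_self {L : ℝ} (hL : 0 < L) (s : ℕ) (r : Coeff) :
    sInner L s r r = sNorm L s r ^ 2 := by
  rw [sNorm_sq hL, sInner]
  congr! 4 with K
  rw [← inner_self_eq_norm_sq (𝕜 := ℂ), PiLp.inner_apply]
  rfl

lemma sInner_proj_left (hr : ∀ K ∉ lowModes N, r K = 0) (L : ℝ) (s : ℕ) (X : Coeff) :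
    sInner L s (proj N X) r = sInner L s X r := by
  simp only [sInner_eq_sum hr]
  exact congrArg _ (Finset.sum_congr rfl fun K hK => by rw [proj_apply_of_mem hK])

end SInner

/-! ### The Leray projection and the nonlinearity -/

section Leray

lemma inner_leray {r : Coeff} (h0 : r 0 = 0) (hdiv : ∀ K, dotK (r K) K = 0) (X : Coeff)
    (K : Fin 3 → ℤ) : inner ℂ (r K) (leray X K) = inner ℂ (r K) (X K) := by
  by_cases hK : K = 0
  · rw [hK, h0, inner_zero_left, inner_zero_left]
  have horth : inner ℂ (r K) (waveVec K) = 0 := by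
    rw [← inner_conj_symm, ← dotK_eq_inner, hdiv, map_zero]
  change inner ℂ (r K) (if K = 0 then 0 else X K - (dotK (X K) K / normSq K) • waveVec K) = _
  rw [if_neg hK, inner_sub_right, inner_smul_right, horth, mul_zero, sub_zero]

lemma leray_of_mem {s : ℕ} {u : Coeff} (hu : u ∈ VSpace s) : leray u = u := by
  funext K
  by_cases hK : K = 0
  · simp [leray, hK, hu.1]
  · simp [leray, hK, hu.2.2.1 K]

lemma leray_sub (u v : Coeff) : leray (u - v) = leray u - leray v := by
  funext K
  by_cases hK : K = 0
  · simp [leray, hK]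
  · simp only [leray, hK, if_false, Pi.sub_apply, dotK_sub, sub_div, sub_smul]
    abel

end Leray

section Bilin

variable (L : ℝ) {u u' v v' p : Coeff}

lemma summable_advect (hu : u ∈ VSpace 0) (hv : v ∈ VSpace 1) (K : Fin 3 → ℤ) :
    Summable fun J => (2 * Real.pi * Complex.I / L * dotK (u J) (K - J)) • v (K - J) := by
  have hv' : Summable fun J => normSq (K - J) * ‖v (K - J)‖ ^ 2 := by
    simpa only [pow_one, Function.comp_def, Equiv.subLeft_apply]
      using (Equiv.subLeft K).summable_iff.2 hv.2.2.2
  refine .of_norm_bounded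
    (((VSpace.summable_norm_sq hu).add hv').mul_left ‖(2 * Real.pi * Complex.I / L : ℂ)‖)
    fun J => ?_
  rw [norm_smul, norm_mul, mul_assoc, ← norm_waveVec_sq]
  gcongr
  calc ‖dotK (u J) (K - J)‖ * ‖v (K - J)‖
      ≤ ‖waveVec (K - J)‖ * ‖u J‖ * ‖v (K - J)‖ := by gcongr; exact norm_dotK_le _ _
    _ ≤ ‖u J‖ ^ 2 + ‖waveVec (K - J)‖ ^ 2 * ‖v (K - J)‖ ^ 2 := by
      nlinarith [two_mul_le_add_sq ‖u J‖ (‖waveVec (K - J)‖ * ‖v (K - J)‖), sq_nonneg ‖u J‖,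
        sq_nonneg (‖waveVec (K - J)‖ * ‖v (K - J)‖)]

lemma advect_sub_left (hu : u ∈ VSpace 0) (hu' : u' ∈ VSpace 0) (hv : v ∈ VSpace 1) :
    advect L (u - u') v = advect L u v - advect L u' v := by
  funext K
  simp only [advect, Pi.sub_apply, dotK_sub, mul_sub, sub_smul]
  exact (summable_advect L hu hv K).tsum_sub (summable_advect L hu' hv K)

lemma advect_sub_right (hu : u ∈ VSpace 0) (hv : v ∈ VSpace 1) (hv' : v' ∈ VSpace 1) :
    advect L u (v - v') = advect L u v - advect L u v' := by
  funext K
  simp only [advect, Pi.sub_apply, smul_sub]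
  exact (summable_advect L hu hv K).tsum_sub (summable_advect L hu hv' K)

lemma bilin_sub_left (hu : u ∈ VSpace 0) (hu' : u' ∈ VSpace 0) (hv : v ∈ VSpace 1) :
    bilin L (u - u') v = bilin L u v - bilin L u' v := by
  rw [bilin, advect_sub_left L hu hu' hv, leray_sub, bilin, bilin]

lemma bilin_sub_right (hu : u ∈ VSpace 0) (hv : v ∈ VSpace 1) (hv' : v' ∈ VSpace 1) :
    bilin L u (v - v') = bilin L u v - bilin L u v' := by
  rw [bilin, advect_sub_right L hu hv hv', leray_sub, bilin, bilin]

/-- The nonlinear error `B(w - p, w - p) - B(u, u)` only involves the part `(w - u) - p` of the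
difference `w - u` that is missed by `p`. -/
lemma bilin_splitting {w : Coeff} (hu : u ∈ VSpace 1) (hw : w ∈ VSpace 1) (hp : p ∈ VSpace 1) :
    bilin L ((w - u) - p) w + bilin L w ((w - u) - p) + bilin L (p - (w - u)) p
        + bilin L (w - u) (p - (w - u))
      = bilin L (w - p) (w - p) - bilin L u u := by
  have mono : ∀ {x}, x ∈ VSpace 1 → x ∈ VSpace 0 := VSpace.mono zero_le_one
  simp only [bilin_sub_left, bilin_sub_right, VSpace.sub, hu, hw, hp, mono hu, mono hw, mono hp]
  abel

end Bilin

/-! ### Fourier series on the torus -/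

section Torus

variable {d : Type*} [Fintype d]

/-- The measure with respect to which Mathlib defines the Fourier coefficients of a function on the
unit torus; there the instance is local, and `volume` would be a different term. -/
abbrev haarTorus (d : Type*) [Fintype d] : Measure (UnitAddTorus d) :=
  Measure.pi fun _ => AddCircle.haarAddCircle

lemma mFourierCoeff_eq_integral_mul (f : UnitAddTorus d → ℂ) (K : d → ℤ) :
    mFourierCoeff f K = ∫ t, mFourier (-K) t * f t ∂haarTorus d := rfl

lemma mFourierCoeff_congr_ae {f g : UnitAddTorus d → ℂ} (h : f =ᵐ[haarTorus d] g) (K : d → ℤ) :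
    mFourierCoeff f K = mFourierCoeff g K :=
  integral_congr_ae (h.mono fun _ ht => by simp only [ht])

lemma norm_mFourier_apply (K : d → ℤ) (t : UnitAddTorus d) : ‖mFourier K t‖ = 1 := by
  simp [mFourier, norm_prod, Circle.norm_coe]

lemma memLp_mFourier_mul {f : UnitAddTorus d → ℂ} {p : ENNReal} (hf : MemLp f p (haarTorus d))
    (K : d → ℤ) : MemLp (fun t => mFourier K t * f t) p (haarTorus d) :=
  hf.of_le ((mFourier K).continuous.aestronglyMeasurable.mul hf.1)
    (.of_forall fun t => by rw [norm_mul, norm_mFourier_apply, one_mul])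

lemma memLp_conj {f : UnitAddTorus d → ℂ} {p : ENNReal} (hf : MemLp f p (haarTorus d)) :
    MemLp (fun t => conj (f t)) p (haarTorus d) :=
  hf.of_le (Complex.continuous_conj.comp_aestronglyMeasurable hf.1)
    (.of_forall fun _ => (RCLike.norm_conj _).le)

lemma hasSum_conj_mFourierCoeff_mul {f g : UnitAddTorus d → ℂ} (hf : MemLp f 2 (haarTorus d))
    (hg : MemLp g 2 (haarTorus d)) :
    HasSum (fun K => conj (mFourierCoeff f K) * mFourierCoeff g K)
      (∫ t, conj (f t) * g t ∂haarTorus d) := by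
  have h := UnitAddTorus.hasSum_prod_mFourierCoeff (hf.toLp f) (hg.toLp g)
  simp only [mFourierCoeff_congr_ae hf.coeFn_toLp, mFourierCoeff_congr_ae hg.coeFn_toLp] at h
  convert! h using 1
  refine integral_congr_ae ?_
  filter_upwards [hf.coeFn_toLp, hg.coeFn_toLp] with t hft hgt
  rw [hft, hgt]

/-- The Fourier coefficients of a product are the convolution of the Fourier coefficients: apply
Parseval's identity to `mFourier K * conj g` and `f`. -/
lemma hasSum_mFourierCoeff_mul {f g : UnitAddTorus d → ℂ} (hf : MemLp f 2 (haarTorus d))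
    (hg : MemLp g 2 (haarTorus d)) (K : d → ℤ) :
    HasSum (fun J => mFourierCoeff f J * mFourierCoeff g (K - J))
      (mFourierCoeff (fun t => f t * g t) K) := by
  convert! hasSum_conj_mFourierCoeff_mul (memLp_mFourier_mul (memLp_conj hg) K) hf using 1
  · funext J
    rw [mul_comm]
    congr 1
    rw [mFourierCoeff_eq_integral_mul, mFourierCoeff_eq_integral_mul, ← integral_conj]
    congr! 2 with _
    rw [map_mul, map_mul, Complex.conj_conj, ← mul_assoc, ← UnitAddTorus.mFourier_neg,
      ← UnitAddTorus.mFourier_neg, ← UnitAddTorus.mFourier_add, neg_neg, neg_sub, sub_eq_add_neg]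
  · rw [mFourierCoeff_eq_integral_mul]
    congr! 2 with t
    rw [map_mul, Complex.conj_conj, UnitAddTorus.mFourier_neg]
    ring

lemma ae_eq_sum_mFourier {f : UnitAddTorus d → ℂ} (hf : MemLp f 2 (haarTorus d))
    {S : Finset (d → ℤ)} (hS : ∀ K ∉ S, mFourierCoeff f K = 0) :
    f =ᵐ[haarTorus d] fun t => ∑ K ∈ S, mFourierCoeff f K * mFourier K t := by
  have hseries := (UnitAddTorus.hasSum_mFourier_series_L2 (hf.toLp f)).unique
    (hasSum_sum_of_ne_finset_zero (s := S) fun K hK => by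
      rw [mFourierCoeff_congr_ae hf.coeFn_toLp, hS K hK, zero_smul])
  have hterm : ∀ᵐ t ∂haarTorus d, ∀ K ∈ S,
      (mFourierCoeff (hf.toLp f) K • UnitAddTorus.mFourierLp 2 K : Lp ℂ 2 (haarTorus d)) t
        = mFourierCoeff f K * mFourier K t := by
    rw [Finset.eventually_all]
    intro K _
    filter_upwards [Lp.coeFn_smul (mFourierCoeff (hf.toLp f) K)
      (UnitAddTorus.mFourierLp 2 K : Lp ℂ 2 (haarTorus d)),
      UnitAddTorus.coeFn_mFourierLp 2 K] with t hsmul hmono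
    rw [hsmul, Pi.smul_apply, hmono, smul_eq_mul, mFourierCoeff_congr_ae hf.coeFn_toLp]
  refine hf.coeFn_toLp.symm.trans ?_
  rw [hseries]
  refine (Lp.coeFn_finsetSum _ _).trans ?_
  filter_upwards [hterm] with t ht
  rw [Finset.sum_apply]
  exact Finset.sum_congr rfl ht

/-- Parseval's identity for an integrable function and a trigonometric polynomial. -/
lemma integral_mul_conj_eq_sum {f h : UnitAddTorus d → ℂ} (hf : Integrable f (haarTorus d))
    (hh : MemLp h 2 (haarTorus d)) {S : Finset (d → ℤ)}
    (hS : ∀ K ∉ S, mFourierCoeff h K = 0) :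
    Integrable (fun t => f t * conj (h t)) (haarTorus d) ∧
      ∫ t, f t * conj (h t) ∂haarTorus d
        = ∑ K ∈ S, mFourierCoeff f K * conj (mFourierCoeff h K) := by
  have hae : (fun t => f t * conj (h t)) =ᵐ[haarTorus d]
      fun t => ∑ K ∈ S, mFourier (-K) t * f t * conj (mFourierCoeff h K) := by
    filter_upwards [ae_eq_sum_mFourier hh hS] with t ht
    rw [ht, map_sum, Finset.mul_sum]
    refine Finset.sum_congr rfl fun K _ => ?_
    rw [map_mul, UnitAddTorus.mFourier_neg]
    ring
  have hint : ∀ K ∈ S, Integrable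
      (fun t => mFourier (-K) t * f t * conj (mFourierCoeff h K)) (haarTorus d) := fun K _ =>
    (memLp_one_iff_integrable.1
      (memLp_mFourier_mul (memLp_one_iff_integrable.2 hf) (-K))).mul_const _
  refine ⟨(integrable_congr hae).2 (integrable_finsetSum S hint), ?_⟩
  rw [integral_congr_ae hae, integral_finsetSum S hint]
  exact Finset.sum_congr rfl fun K _ => integral_mul_const _ _

lemma exists_memLp_mFourierCoeff_eq {a : (d → ℤ) → ℂ} (ha : Summable fun K => ‖a K‖ ^ 2) :
    ∃ f : UnitAddTorus d → ℂ, MemLp f 2 (haarTorus d) ∧ ∀ K, mFourierCoeff f K = a K := by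
  let F := UnitAddTorus.mFourierBasis.repr.symm ⟨a, memℓp_gen (by simpa using ha)⟩
  refine ⟨F, Lp.memLp F, fun K => ?_⟩
  rw [← UnitAddTorus.mFourierBasis_repr, LinearIsometryEquiv.apply_symm_apply]

lemma exists_real_memLp_mFourierCoeff_eq {a : (d → ℤ) → ℂ} (ha : Summable fun K => ‖a K‖ ^ 2)
    (hsymm : ∀ K, a (-K) = conj (a K)) :
    ∃ f : UnitAddTorus d → ℝ, MemLp f 2 (haarTorus d) ∧
      ∀ K, mFourierCoeff (fun t => (f t : ℂ)) K = a K := by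
  obtain ⟨F, hF, hFa⟩ := exists_memLp_mFourierCoeff_eq ha
  have hre : ∀ K t, mFourier (-K) t * ((F t).re : ℂ)
      = (mFourier (-K) t * F t + conj (mFourier (- -K) t * F t)) / 2 := fun K t => by
    rw [map_mul, ← UnitAddTorus.mFourier_neg, neg_neg, Complex.re_eq_add_conj]
    ring
  have hint : ∀ J, MemLp (fun t => mFourier J t * F t) 1 (haarTorus d) := fun J =>
    (memLp_mFourier_mul hF J).mono_exponent (by norm_num)
  refine ⟨fun t => (F t).re, hF.re, fun K => ?_⟩
  rw [mFourierCoeff_eq_integral_mul]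
  simp only [hre]
  rw [integral_div, integral_add (memLp_one_iff_integrable.1 (hint _))
    (memLp_one_iff_integrable.1 (memLp_conj (hint _))), integral_conj,
    ← mFourierCoeff_eq_integral_mul, ← mFourierCoeff_eq_integral_mul, hFa, hFa, hsymm,
    Complex.conj_conj]
  ring

/-- `G` is a square integrable real vector field with Fourier coefficients `a`. -/
structure HasFourierCoeff {ι : Type*} [Fintype ι] (G : UnitAddTorus d → EuclideanSpace ℝ ι)
    (a : (d → ℤ) → EuclideanSpace ℂ ι) : Prop where
  memLp : MemLp G 2 (haarTorus d)
  coeff : ∀ K j, mFourierCoeff (fun t => (G t j : ℂ)) K = a K j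

namespace HasFourierCoeff

variable {ι : Type*} [Fintype ι] {G : UnitAddTorus d → EuclideanSpace ℝ ι}
  {a : (d → ℤ) → EuclideanSpace ℂ ι}

lemma memLp_apply (hG : HasFourierCoeff G a) (j : ι) :
    MemLp (fun t => G t j) 2 (haarTorus d) :=
  (memLp_piLp_iff (p := 2) (q := 2)).1 hG.memLp j

lemma memLp_ofReal (hG : HasFourierCoeff G a) (j : ι) :
    MemLp (fun t => (G t j : ℂ)) 2 (haarTorus d) :=
  (hG.memLp_apply j).ofReal

lemma exists_of_summable (ha : Summable fun K => ‖a K‖ ^ 2)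
    (hsymm : ∀ K j, a (-K) j = conj (a K j)) :
    ∃ G : UnitAddTorus d → EuclideanSpace ℝ ι, HasFourierCoeff G a := by
  have haj : ∀ j, Summable fun K => ‖a K j‖ ^ 2 := fun j =>
    ha.of_nonneg_of_le (fun K => sq_nonneg _) fun K => by gcongr; exact PiLp.norm_apply_le _ _
  choose f hf hfa using fun j => exists_real_memLp_mFourierCoeff_eq (haj j) (hsymm · j)
  exact ⟨fun t => WithLp.toLp 2 fun j => f j t, (memLp_piLp_iff (p := 2) (q := 2)).2 hf,
    fun K j => hfa j K⟩

lemma hasSum_norm_sq_apply (hG : HasFourierCoeff G a) (j : ι) :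
    HasSum (fun K => ‖a K j‖ ^ 2) (∫ t, G t j ^ 2 ∂haarTorus d) := by
  have h := Complex.hasSum_re
    (hasSum_conj_mFourierCoeff_mul (hG.memLp_ofReal j) (hG.memLp_ofReal j))
  simpa only [hG.coeff, Complex.conj_mul', Complex.norm_real, ← Complex.ofReal_pow,
    Complex.ofReal_re, integral_complex_ofReal, Real.norm_eq_abs, sq_abs] using h

lemma toReal_eLpNorm_sq (hG : HasFourierCoeff G a) :
    (eLpNorm G 2 (haarTorus d)).toReal ^ 2 = ∑' K, ‖a K‖ ^ 2 := by
  calc (eLpNorm G 2 (haarTorus d)).toReal ^ 2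
      = ∫ t, ‖G t‖ ^ 2 ∂haarTorus d := by
        rw [hG.memLp.eLpNorm_eq_integral_rpow_norm (by norm_num) (by norm_num),
          ENNReal.toReal_ofReal (by positivity)]
        simp only [ENNReal.toReal_ofNat, Real.rpow_two, ← one_div, ← Real.sqrt_eq_rpow]
        exact Real.sq_sqrt (by positivity)
    _ = ∑ j, ∫ t, G t j ^ 2 ∂haarTorus d := by
        simp only [EuclideanSpace.norm_sq_eq, Real.norm_eq_abs, sq_abs]
        exact integral_finsetSum _ fun j _ => (hG.memLp_apply j).integrable_sq
    _ = ∑' K, ‖a K‖ ^ 2 := by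
        simp only [EuclideanSpace.norm_sq_eq]
        exact (hasSum_sum fun j _ => hG.hasSum_norm_sq_apply j).tsum_eq.symm

end HasFourierCoeff

end Torus

/-! ### The trilinear form -/

lemma integral_mul_mul_eq_sum {d : Type*} [Fintype d] {f g h : UnitAddTorus d → ℝ}
    (hf : MemLp f 2 (haarTorus d)) (hg : MemLp g 2 (haarTorus d)) (hh : MemLp h 2 (haarTorus d))
    {S : Finset (d → ℤ)} (hS : ∀ K ∉ S, mFourierCoeff (fun t => (h t : ℂ)) K = 0) :
    Integrable (fun t => f t * g t * h t) (haarTorus d) ∧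
      ((∫ t, f t * g t * h t ∂haarTorus d : ℝ) : ℂ)
        = ∑ K ∈ S, mFourierCoeff (fun t => (f t : ℂ) * g t) K
            * conj (mFourierCoeff (fun t => (h t : ℂ)) K) := by
  have hfg : Integrable (fun t => (f t : ℂ) * g t) (haarTorus d) :=
    hf.ofReal.integrable_mul hg.ofReal
  have hhc : MemLp (fun t => (h t : ℂ)) 2 (haarTorus d) := hh.ofReal
  obtain ⟨hint, hsum⟩ := integral_mul_conj_eq_sum hfg hhc hS
  refine ⟨?_, ?_⟩
  · simpa using hint.re
  · simpa only [Complex.conj_ofReal, ← Complex.ofReal_mul, integral_complex_ofReal] using hsum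

/-- The Fourier coefficients `(2πi/L) K_i û_K,j` of the gradient `∂_i u_j`. -/
def gradCoeff (L : ℝ) (u : Coeff) (K : Fin 3 → ℤ) : EuclideanSpace ℂ (Fin 3 × Fin 3) :=
  WithLp.toLp 2 fun p => 2 * Real.pi * Complex.I / L * K p.1 * u K p.2

lemma norm_gradCoeff_sq (L : ℝ) (u : Coeff) (K : Fin 3 → ℤ) :
    ‖gradCoeff L u K‖ ^ 2 = lam L K * ‖u K‖ ^ 2 := by
  simp only [gradCoeff, EuclideanSpace.norm_sq_eq, Fintype.sum_prod_type, norm_mul, mul_pow,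
    ← Finset.mul_sum, ← Finset.sum_mul]
  congr 1
  simp [lam, normSq, div_pow, mul_pow]
  ring

lemma gradCoeff_neg (L : ℝ) {s : ℕ} {u : Coeff} (hu : u ∈ VSpace s) (K : Fin 3 → ℤ)
    (p : Fin 3 × Fin 3) : gradCoeff L u (-K) p = conj (gradCoeff L u K p) := by
  simp only [gradCoeff, Pi.neg_apply, hu.2.1 K, Int.cast_neg, map_mul, map_div₀, Complex.conj_I,
    Complex.conj_ofReal, map_intCast, map_ofNat]
  ring

section Fields

variable {L : ℝ} {u v r : Coeff} {S : Finset (Fin 3 → ℤ)}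
  {A B R : UnitAddTorus (Fin 3) → EuclideanSpace ℝ (Fin 3)}
  {D : UnitAddTorus (Fin 3) → EuclideanSpace ℝ (Fin 3 × Fin 3)}

lemma VSpace.exists_hasFourierCoeff {s : ℕ} (hu : u ∈ VSpace s) :
    ∃ A : UnitAddTorus (Fin 3) → EuclideanSpace ℝ (Fin 3), HasFourierCoeff A u :=
  HasFourierCoeff.exists_of_summable (VSpace.summable_norm_sq hu) hu.2.1

lemma VSpace.exists_hasFourierCoeff_gradCoeff (L : ℝ) (hu : u ∈ VSpace 1) :
    ∃ D : UnitAddTorus (Fin 3) → EuclideanSpace ℝ (Fin 3 × Fin 3),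
      HasFourierCoeff D (gradCoeff L u) :=
  HasFourierCoeff.exists_of_summable
    (by simpa only [norm_gradCoeff_sq, pow_one] using VSpace.summable_lam L hu)
    (gradCoeff_neg L hu)

lemma HasFourierCoeff.ofReal_mul_eLpNorm_gradCoeff (hL : 0 < L)
    (hD : HasFourierCoeff D (gradCoeff L u)) :
    ENNReal.ofReal (L ^ (3 / 2 : ℝ)) * eLpNorm D 2 (haarTorus (Fin 3))
      = ENNReal.ofReal (sNorm L 1 u) := by
  rw [← ENNReal.ofReal_toReal hD.memLp.eLpNorm_ne_top, ← ENNReal.ofReal_mul (by positivity)]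
  congr 1
  refine (sq_eq_sq₀ (by positivity) (sNorm_nonneg _ _ _)).1 ?_
  rw [mul_pow, hD.toReal_eLpNorm_sq, sNorm_sq hL, ← Real.rpow_natCast, ← Real.rpow_mul hL.le]
  simp only [norm_gradCoeff_sq, pow_one]
  norm_num

lemma advect_apply_eq_sum_gradCoeff (hA : HasFourierCoeff A u)
    (hD : HasFourierCoeff D (gradCoeff L v)) (hu : u ∈ VSpace 0) (hv : v ∈ VSpace 1)
    (K : Fin 3 → ℤ) (j : Fin 3) :
    advect L u v K j = ∑ i, mFourierCoeff (fun t => (A t i : ℂ) * D t (i, j)) K := by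
  refine ((summable_advect L hu hv K).hasSum.mapL (EuclideanSpace.proj (𝕜 := ℂ) j)).unique ?_
  convert! hasSum_sum fun i (_ : i ∈ Finset.univ) =>
    hasSum_mFourierCoeff_mul (hA.memLp_ofReal i) (hD.memLp_ofReal (i, j)) K using 2 with J
  simp only [hA.coeff, hD.coeff, gradCoeff, map_smul, PiLp.proj_apply, smul_eq_mul, dotK,
    Finset.mul_sum, Finset.sum_mul]
  exact Finset.sum_congr rfl fun i _ => by ring

/-- Integration by parts: as `u` is divergence free, `(u·∇)v = ∑ᵢ ∂ᵢ(uᵢ v)`. -/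
lemma advect_apply_eq_sum_of_div_free (hA : HasFourierCoeff A u) (hB : HasFourierCoeff B v)
    (hu : u ∈ VSpace 0) (hv : v ∈ VSpace 1) (K : Fin 3 → ℤ) (j : Fin 3) :
    advect L u v K j
      = ∑ i, 2 * Real.pi * Complex.I / L * K i
          * mFourierCoeff (fun t => (A t i : ℂ) * B t j) K := by
  refine ((summable_advect L hu hv K).hasSum.mapL (EuclideanSpace.proj (𝕜 := ℂ) j)).unique ?_
  convert! hasSum_sum fun i (_ : i ∈ Finset.univ) =>
    (hasSum_mFourierCoeff_mul (hA.memLp_ofReal i) (hB.memLp_ofReal j) K).mul_left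
      (2 * Real.pi * Complex.I / L * K i) using 2 with J
  have hdiv : dotK (u J) (K - J) = dotK (u J) K := by
    have hJ : dotK (u J) J = 0 := hu.2.2.1 J
    simp only [dotK, Pi.sub_apply, Int.cast_sub, mul_sub, Finset.sum_sub_distrib] at hJ ⊢
    rw [hJ, sub_zero]
  simp only [hA.coeff, hB.coeff, map_smul, PiLp.proj_apply, smul_eq_mul, hdiv]
  simp only [dotK, Finset.mul_sum, Finset.sum_mul]
  exact Finset.sum_congr rfl fun i _ => by ring

lemma sInner_bilin_eq_re_sum (hr : r ∈ VSpace 0) (hS : ∀ K ∉ S, r K = 0) :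
    sInner L 0 (bilin L u v) r
      = L ^ 3 * (∑ K ∈ S, ∑ j, advect L u v K j * conj (r K j)).re := by
  rw [sInner_eq_sum hS, Complex.re_sum]
  simp only [bilin, inner_leray hr.1 hr.2.2.1, pow_zero, one_mul, PiLp.inner_apply,
    RCLike.inner_apply]

lemma sInner_bilin_eq_integral (hA : HasFourierCoeff A u) (hD : HasFourierCoeff D (gradCoeff L v))
    (hR : HasFourierCoeff R r) (hu : u ∈ VSpace 0) (hv : v ∈ VSpace 1) (hr : r ∈ VSpace 0)
    (hS : ∀ K ∉ S, r K = 0) :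
    sInner L 0 (bilin L u v) r
      = L ^ 3 * ∫ t, ∑ p : Fin 3 × Fin 3, A t p.1 * R t p.2 * D t p ∂haarTorus (Fin 3) := by
  have htriple := fun p : Fin 3 × Fin 3 => integral_mul_mul_eq_sum (hA.memLp_apply p.1)
    (hD.memLp_apply p) (hR.memLp_apply p.2) (S := S) fun K hK => by rw [hR.coeff, hS K hK]; rfl
  have hcomm : ∀ t (p : Fin 3 × Fin 3),
      A t p.1 * R t p.2 * D t p = A t p.1 * D t p * R t p.2 := fun t p => mul_right_comm _ _ _
  rw [sInner_bilin_eq_re_sum hr hS, ← Complex.ofReal_re (∫ t, _ ∂_)]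
  simp only [hcomm]
  rw [integral_finsetSum _ fun p _ => (htriple p).1, Complex.ofReal_sum]
  simp only [(htriple _).2, hR.coeff, advect_apply_eq_sum_gradCoeff hA hD hu hv, Finset.sum_mul]
  rw [Finset.sum_comm, Fintype.sum_prod_type_right]
  congr! 3
  exact Finset.sum_comm

lemma sInner_bilin_eq_neg_integral (hA : HasFourierCoeff A u) (hB : HasFourierCoeff B v)
    (hD : HasFourierCoeff D (gradCoeff L r)) (hu : u ∈ VSpace 0) (hv : v ∈ VSpace 1)
    (hr : r ∈ VSpace 0) (hS : ∀ K ∉ S, r K = 0) :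
    sInner L 0 (bilin L u v) r
      = -(L ^ 3 * ∫ t, ∑ p : Fin 3 × Fin 3, A t p.1 * B t p.2 * D t p ∂haarTorus (Fin 3)) := by
  have htriple := fun p : Fin 3 × Fin 3 => integral_mul_mul_eq_sum (hA.memLp_apply p.1)
    (hB.memLp_apply p.2) (hD.memLp_apply p) (S := S) fun K hK => by
      rw [hD.coeff]; simp [gradCoeff, hS K hK]
  rw [sInner_bilin_eq_re_sum hr hS, ← mul_neg, ← Complex.ofReal_re (∫ t, _ ∂_), ← Complex.neg_re,
    integral_finsetSum _ fun p _ => (htriple p).1, Complex.ofReal_sum]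
  simp only [(htriple _).2, hD.coeff, advect_apply_eq_sum_of_div_free hA hB hu hv, Finset.sum_mul,
    ← Finset.sum_neg_distrib]
  rw [Finset.sum_comm, Fintype.sum_prod_type_right]
  congr! 3
  rw [Finset.sum_comm]
  congr! 2
  simp only [gradCoeff, map_mul, map_div₀, Complex.conj_I, Complex.conj_ofReal, map_intCast,
    map_ofNat]
  ring

end Fields

section Holder

variable {ι κ : Type*} [Fintype ι] [Fintype κ]

lemma abs_sum_mul_le_norm_mul (a : EuclideanSpace ℝ ι) (b : EuclideanSpace ℝ κ)
    (d : EuclideanSpace ℝ (ι × κ)) : |∑ p, a p.1 * b p.2 * d p| ≤ ‖a‖ * ‖b‖ * ‖d‖ := by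
  let ab : EuclideanSpace ℝ (ι × κ) := WithLp.toLp 2 fun p => a p.1 * b p.2
  have hab : ‖ab‖ = ‖a‖ * ‖b‖ := by
    refine (sq_eq_sq₀ (norm_nonneg _) (by positivity)).1 ?_
    rw [mul_pow, EuclideanSpace.norm_sq_eq, EuclideanSpace.norm_sq_eq, EuclideanSpace.norm_sq_eq,
      Fintype.sum_prod_type, Finset.sum_mul_sum]
    simp [ab, mul_pow]
  have hinner : ∑ p, a p.1 * b p.2 * d p = inner ℝ ab d := by
    simp [ab, PiLp.inner_apply, mul_comm]
  rw [hinner, ← hab]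
  exact abs_real_inner_le_norm _ _

lemma enorm_integral_sum_mul_le {X : Type*} [MeasurableSpace X] {μ : Measure X} {p q : ENNReal}
    [ENNReal.HolderTriple p q 2] {A : X → EuclideanSpace ℝ ι} {B : X → EuclideanSpace ℝ κ}
    {D : X → EuclideanSpace ℝ (ι × κ)} (hA : AEStronglyMeasurable A μ)
    (hB : AEStronglyMeasurable B μ) (hD : AEStronglyMeasurable D μ) :
    ‖∫ x, ∑ k, A x k.1 * B x k.2 * D x k ∂μ‖ₑ
      ≤ eLpNorm A p μ * eLpNorm B q μ * eLpNorm D 2 μ := by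
  calc ‖∫ x, ∑ k, A x k.1 * B x k.2 * D x k ∂μ‖ₑ
      ≤ eLpNorm (fun x => ∑ k, A x k.1 * B x k.2 * D x k) 1 μ := by
        rw [eLpNorm_one_eq_lintegral_enorm]
        exact enorm_integral_le_lintegral_enorm _
    _ ≤ eLpNorm (((fun x => ‖A x‖) • fun x => ‖B x‖) • fun x => ‖D x‖) 1 μ :=
        eLpNorm_mono fun x => by
          simpa [abs_mul] using abs_sum_mul_le_norm_mul (A x) (B x) (D x)
    _ ≤ eLpNorm ((fun x => ‖A x‖) • fun x => ‖B x‖) 2 μ * eLpNorm (fun x => ‖D x‖) 2 μ :=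
        eLpNorm_smul_le_mul_eLpNorm hD.norm (hA.norm.smul hB.norm)
    _ ≤ eLpNorm A p μ * eLpNorm B q μ * eLpNorm D 2 μ := by
        rw [eLpNorm_norm D, ← eLpNorm_norm A, ← eLpNorm_norm B]
        gcongr
        exact eLpNorm_smul_le_mul_eLpNorm hB.norm hA.norm

end Holder

section Estimates

variable {L c : ℝ} {u v r : Coeff} {S : Finset (Fin 3 → ℤ)}
  {A B : UnitAddTorus (Fin 3) → EuclideanSpace ℝ (Fin 3)}
  {D : UnitAddTorus (Fin 3) → EuclideanSpace ℝ (Fin 3 × Fin 3)}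

lemma ofReal_abs_integral_le_boxLpNorm_mul (hL : 0 < L) {p q : ℕ} (hpq : Real.HolderTriple p q 2)
    (hA : HasFourierCoeff A u) (hB : HasFourierCoeff B v)
    (hD : HasFourierCoeff D (gradCoeff L r)) :
    ENNReal.ofReal |L ^ 3 * ∫ t, ∑ k : Fin 3 × Fin 3, A t k.1 * B t k.2 * D t k
        ∂haarTorus (Fin 3)|
      ≤ boxLpNorm L p A * boxLpNorm L q B * ENNReal.ofReal (sNorm L 1 r) := by
  have htriple : ENNReal.HolderTriple p q 2 := ENNReal.HolderTriple.of_toReal (by simpa)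
  have hpow : L ^ 3 = L ^ ((3 : ℝ) / p) * L ^ ((3 : ℝ) / q) * L ^ (3 / 2 : ℝ) := by
    rw [← Real.rpow_add hL, ← Real.rpow_add hL, div_eq_mul_inv, div_eq_mul_inv, ← mul_add,
      hpq.inv_add_inv_eq_inv, ← Real.rpow_natCast]
    norm_num
  rw [abs_mul, abs_of_pos (pow_pos hL 3), ENNReal.ofReal_mul (by positivity), ← Real.norm_eq_abs,
    ofReal_norm, ← hD.ofReal_mul_eLpNorm_gradCoeff hL]
  refine (mul_le_mul_right (enorm_integral_sum_mul_le (p := p) (q := q)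
    hA.memLp.1 hB.memLp.1 hD.memLp.1) _).trans_eq ?_
  rw [hpow, ENNReal.ofReal_mul (by positivity), ENNReal.ofReal_mul (by positivity), boxLpNorm,
    boxLpNorm, torusMeasure]
  ring

lemma HasFourierCoeff.fieldCoeff_eq (hA : HasFourierCoeff A u) : fieldCoeff A = u := by
  ext K j
  exact hA.coeff K j

lemma IsGagliardoNirenbergConst.abs (hc : IsGagliardoNirenbergConst L c) :
    IsGagliardoNirenbergConst L |c| := by
  intro G hG hGV
  obtain ⟨h3, h4, h6⟩ := hc G hG hGV
  have h0 := sNorm_nonneg L 0 (fieldCoeff G)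
  have h1 := sNorm_nonneg L 1 (fieldCoeff G)
  exact ⟨h3.trans (by gcongr; exact le_abs_self c), h4.trans (by gcongr; exact le_abs_self c),
    h6.trans (by gcongr; exact le_abs_self c)⟩

lemma IsGagliardoNirenbergConst.boxLpNorm_mul_le (hc : IsGagliardoNirenbergConst L c)
    (hA : HasFourierCoeff A u) (hu : u ∈ VSpace 1) (hB : HasFourierCoeff B v) (hv : v ∈ VSpace 1) :
    boxLpNorm L 3 A * boxLpNorm L 6 B ≤ ENNReal.ofReal
      (c ^ 2 * (sNorm L 0 u ^ (1 / 2 : ℝ) * sNorm L 1 u ^ (1 / 2 : ℝ)) * sNorm L 1 v) := by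
  have hA3 := (hc.abs A hA.memLp (hA.fieldCoeff_eq ▸ hu)).1
  have hB6 := (hc.abs B hB.memLp (hB.fieldCoeff_eq ▸ hv)).2.2
  rw [hA.fieldCoeff_eq] at hA3
  rw [hB.fieldCoeff_eq] at hB6
  have h0 := sNorm_nonneg L 0 u
  have h1 := sNorm_nonneg L 1 u
  refine (mul_le_mul' hA3 hB6).trans_eq ?_
  rw [← ENNReal.ofReal_mul (by positivity), ← sq_abs c]
  congr 1
  ring

/-- Hölder's inequality with exponents `(3, 2, 6)` for `(u, ∇v, r)`. -/
lemma abs_sInner_bilin_le_left (hL : 0 < L) (hc : IsGagliardoNirenbergConst L c)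
    (hu : u ∈ VSpace 1) (hv : v ∈ VSpace 1) (hr : r ∈ VSpace 1) (hS : ∀ K ∉ S, r K = 0) :
    |sInner L 0 (bilin L u v) r|
      ≤ c ^ 2 * (sNorm L 0 u ^ (1 / 2 : ℝ) * sNorm L 1 u ^ (1 / 2 : ℝ)) * sNorm L 1 v
        * sNorm L 1 r := by
  obtain ⟨A, hA⟩ := VSpace.exists_hasFourierCoeff hu
  obtain ⟨R, hR⟩ := VSpace.exists_hasFourierCoeff hr
  obtain ⟨D, hD⟩ := VSpace.exists_hasFourierCoeff_gradCoeff L hv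
  have h0 := sNorm_nonneg L 0 u
  have h1 := sNorm_nonneg L 1 u
  have hv1 := sNorm_nonneg L 1 v
  have hr1 := sNorm_nonneg L 1 r
  rw [sInner_bilin_eq_integral hA hD hR (VSpace.mono zero_le_one hu) hv
    (VSpace.mono zero_le_one hr) hS, ← ENNReal.ofReal_le_ofReal_iff (by positivity)]
  refine (ofReal_abs_integral_le_boxLpNorm_mul hL (p := 3) (q := 6)
    ⟨by norm_num, by norm_num, by norm_num⟩ hA hR hD).trans ?_
  refine (mul_le_mul_left (hc.boxLpNorm_mul_le hA hu hR hr) _).trans_eq ?_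
  rw [← ENNReal.ofReal_mul (by positivity), mul_right_comm]

/-- Hölder's inequality with exponents `(6, 3, 2)` for `(u, v, ∇r)`. -/
lemma abs_sInner_bilin_le_right (hL : 0 < L) (hc : IsGagliardoNirenbergConst L c)
    (hu : u ∈ VSpace 1) (hv : v ∈ VSpace 1) (hr : r ∈ VSpace 1) (hS : ∀ K ∉ S, r K = 0) :
    |sInner L 0 (bilin L u v) r|
      ≤ c ^ 2 * (sNorm L 0 v ^ (1 / 2 : ℝ) * sNorm L 1 v ^ (1 / 2 : ℝ)) * sNorm L 1 u
        * sNorm L 1 r := by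
  obtain ⟨A, hA⟩ := VSpace.exists_hasFourierCoeff hu
  obtain ⟨B, hB⟩ := VSpace.exists_hasFourierCoeff hv
  obtain ⟨D, hD⟩ := VSpace.exists_hasFourierCoeff_gradCoeff L hr
  have h0 := sNorm_nonneg L 0 v
  have h1 := sNorm_nonneg L 1 v
  have hu1 := sNorm_nonneg L 1 u
  have hr1 := sNorm_nonneg L 1 r
  rw [sInner_bilin_eq_neg_integral hA hB hD (VSpace.mono zero_le_one hu) hv
    (VSpace.mono zero_le_one hr) hS, abs_neg, ← ENNReal.ofReal_le_ofReal_iff (by positivity)]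
  refine (ofReal_abs_integral_le_boxLpNorm_mul hL (p := 6) (q := 3)
    ⟨by norm_num, by norm_num, by norm_num⟩ hA hB hD).trans ?_
  rw [mul_comm (boxLpNorm L 6 A)]
  refine (mul_le_mul_left (hc.boxLpNorm_mul_le hB hv hA hu) _).trans_eq ?_
  rw [← ENNReal.ofReal_mul (by positivity)]

end Estimates

/-! ### Measurability and regularity in time -/

section Measurability

variable {X : Type*} [MeasurableSpace X] {μ : Measure X} {x y : X → Coeff}

lemma measurable_proj (N : ℕ) : Measurable (proj N) := by
  refine measurable_pi_iff.2 fun K => ?_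
  by_cases hK : K ∈ lowModes N
  · simpa only [proj_apply_of_mem hK] using measurable_pi_apply K
  · simpa only [proj_apply_of_notMem hK] using measurable_const

lemma measurable_stokes (L : ℝ) : Measurable (stokes L) :=
  measurable_pi_iff.2 fun K => (measurable_pi_apply K).const_smul (lam L K)

lemma measurable_dotK (K : Fin 3 → ℤ) : Measurable fun a => dotK a K := by
  simp only [dotK_eq_inner]
  fun_prop

lemma measurable_leray : Measurable leray := by
  refine measurable_pi_iff.2 fun K => ?_
  unfold leray
  split_ifs
  · exact measurable_const
  · exact (measurable_pi_apply K).sub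
      ((((measurable_dotK K).comp (measurable_pi_apply K)).div_const _).smul_const _)

lemma aemeasurable_bilin (L : ℝ) (hx : AEMeasurable x μ) (hy : AEMeasurable y μ)
    (hxV : ∀ᵐ t ∂μ, x t ∈ VSpace 0) (hyV : ∀ᵐ t ∂μ, y t ∈ VSpace 1) :
    AEMeasurable (fun t => bilin L (x t) (y t)) μ := by
  refine measurable_leray.comp_aemeasurable (aemeasurable_pi_iff.2 fun K => ?_)
  refine aemeasurable_of_tendsto_metrizable_ae atTop (f := fun (S : Finset (Fin 3 → ℤ)) t =>
    ∑ J ∈ S, (2 * Real.pi * Complex.I / L * dotK (x t J) (K - J)) • y t (K - J)) (fun S => ?_) ?_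
  · exact Finset.aemeasurable_fun_sum S fun J _ =>
      (((measurable_dotK _).comp_aemeasurable (aemeasurable_pi_iff.1 hx J)).const_mul _).smul
        (aemeasurable_pi_iff.1 hy _)
  · filter_upwards [hxV, hyV] with t hxt hyt
    exact (summable_advect L hxt hyt K).hasSum

lemma aemeasurable_sInner (hx : AEMeasurable x μ) (hy : AEMeasurable y μ)
    {S : Finset (Fin 3 → ℤ)} (hS : ∀ t, ∀ K ∉ S, y t K = 0) (L : ℝ) (s : ℕ) :
    AEMeasurable (fun t => sInner L s (x t) (y t)) μ := by
  simp only [fun t => sInner_eq_sum (hS t) L s (x t)]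
  refine (Finset.aemeasurable_fun_sum S fun K _ => ?_).const_mul _
  exact (Complex.measurable_re.comp_aemeasurable
    ((aemeasurable_pi_iff.1 hy K).inner (aemeasurable_pi_iff.1 hx K))).const_mul _

end Measurability

section Regular

variable {L ν a b : ℝ} {N : ℕ} {u : ℝ → Coeff}

namespace IsRegular

lemma continuousOn_mode (h : IsRegular L a b u) (hab : a ≤ b) (K : Fin 3 → ℤ) :
    ContinuousOn (fun t => u t K) (Set.Icc a b) := by
  have hprim := intervalIntegral.continuousOn_primitive_interval' (h.deriv_int K) Set.left_mem_uIcc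
  rw [Set.uIcc_of_le hab] at hprim
  exact (continuousOn_const.add hprim).congr (h.ftc K)

lemma ae_hasDerivAt (h : IsRegular L a b u) (hab : a ≤ b) :
    ∀ᵐ t ∂volume.restrict (Set.Icc a b), ∀ K,
      HasDerivAt (fun s => u s K) (timeDeriv u t K) t := by
  refine ae_all_iff.2 fun K => ?_
  rw [← restrict_Ioo_eq_restrict_Icc, ae_restrict_iff' measurableSet_Ioo]
  filter_upwards [(h.deriv_int K).ae_hasDerivAt_integral] with t ht hmem
  rw [Set.uIcc_of_le hab] at ht
  have hderiv := (ht (Set.Ioo_subset_Icc_self hmem) a (Set.left_mem_Icc.2 hab)).const_add (u a K)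
  refine hderiv.congr_of_eventuallyEq ?_
  filter_upwards [Ioo_mem_nhds hmem.1 hmem.2] with s hs
  exact h.ftc K s (Set.Ioo_subset_Icc_self hs)

lemma continuousOn_sNorm (h : IsRegular L a b u) :
    ContinuousOn (fun t => sNorm L 1 (u t)) (Set.Icc a b) := by
  intro t ht
  rw [ContinuousWithinAt, tendsto_iff_dist_tendsto_zero]
  refine squeeze_zero' (.of_forall fun _ => dist_nonneg) ?_ (h.cont_V t ht)
  filter_upwards [self_mem_nhdsWithin] with s hs
  exact abs_sNorm_sub_sNorm_le L (h.mem_V s hs) (h.mem_V t ht)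

lemma aemeasurable (h : IsRegular L a b u) (hab : a ≤ b) :
    AEMeasurable u (volume.restrict (Set.Icc a b)) :=
  aemeasurable_pi_iff.2 fun K => (h.continuousOn_mode hab K).aemeasurable measurableSet_Icc

lemma aemeasurable_timeDeriv (h : IsRegular L a b u) :
    AEMeasurable (timeDeriv u) (volume.restrict (Set.Icc a b)) := by
  refine aemeasurable_pi_iff.2 fun K => ?_
  rw [← restrict_Ioc_eq_restrict_Icc]
  exact (h.deriv_int K).aestronglyMeasurable.aemeasurable

lemma aemeasurable_resid (h : IsRegular L a b u) (hab : a ≤ b) :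
    AEMeasurable (resid L ν N u) (volume.restrict (Set.Icc a b)) :=
  (measurable_proj N).comp_aemeasurable (h.aemeasurable_timeDeriv.add
    (((measurable_stokes L).comp_aemeasurable (h.aemeasurable hab)).const_smul ν))

lemma ae_resid_mem (h : IsRegular L a b u) (s : ℕ) :
    ∀ᵐ t ∂volume.restrict (Set.Icc a b), resid L ν N u t ∈ VSpace s := by
  filter_upwards [h.deriv_mem_H, h.mem_DA] with t hderiv hDA
  exact VSpace.proj N (VSpace.add hderiv (VSpace.real_smul ν (VSpace.stokes L hDA)))

end IsRegular

lemma resid_apply_of_notMem {K : Fin 3 → ℤ} (hK : K ∉ lowModes N) (t : ℝ) :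
    resid L ν N u t K = 0 :=
  proj_apply_of_notMem hK _

end Regular

/-! ### The balance between the two systems -/

section Balance

variable {L ν α β η a b : ℝ} {N : ℕ} {f u w : ℝ → Coeff}

lemma IsRegular.ae_timeDeriv_helm (h : IsRegular L a b u) (hab : a ≤ b) (α : ℝ) :
    ∀ᵐ t ∂volume.restrict (Set.Icc a b),
      timeDeriv (fun s => helm L α (u s)) t = helm L α (timeDeriv u t) := by
  filter_upwards [h.ae_hasDerivAt hab] with t ht
  funext K
  exact ((ht K).add (((ht K).const_smul (lam L K)).const_smul (α ^ 2))).deriv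

lemma IsRegular.ae_timeDeriv_proj_sub (hu : IsRegular L a b u) (hw : IsRegular L a b w)
    (hab : a ≤ b) (N : ℕ) :
    ∀ᵐ t ∂volume.restrict (Set.Icc a b),
      timeDeriv (fun s => proj N (w s - u s)) t = proj N (timeDeriv w t - timeDeriv u t) := by
  filter_upwards [hu.ae_hasDerivAt hab, hw.ae_hasDerivAt hab] with t hut hwt
  funext K
  by_cases hK : K ∈ lowModes N
  · simp only [timeDeriv, proj_apply_of_mem hK]
    exact ((hwt K).sub (hut K)).deriv
  · simp only [timeDeriv, proj_apply_of_notMem hK, deriv_const]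

/-- The field whose inner product with the residual `P_N (u_t + νAu)` is the integrand of the
parameter update. Collecting the powers of `β` displays it as `I + β²A` applied to the linear part
of the equation for `P_N (w - u)`, plus the computable part of the nonlinearity. -/
def updateField (L ν β η : ℝ) (N : ℕ) (u w : ℝ → Coeff) (s : ℝ) : Coeff :=
  helm L β (timeDeriv (fun s => proj N (w s - u s)) s + ν • stokes L (proj N (w s - u s))
      + η • proj N (w s - u s))
    + (proj N (bilin L (w s) (w s))
      - proj N (bilin L (w s - proj N (w s - u s)) (w s - proj N (w s - u s))))

lemma updatedBetaSq_eq (L ν β η : ℝ) (N : ℕ) (u w : ℝ → Coeff) (τ T : ℝ) :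
    updatedBetaSq L ν β η N u w τ T
      = β ^ 2 + (delta L ν N u τ T)⁻¹ *
        ∫ s in τ..T, sInner L 0 (updateField L ν β η N u w s) (resid L ν N u s) := by
  rw [updatedBetaSq, one_div]
  congr! 4 with s
  have hr : ∀ K ∉ lowModes N, resid L ν N u s K = 0 := fun K hK => resid_apply_of_notMem hK s
  simp only [updateField, helm, sInner_add_left hr, sInner_smul_left hr, sInner_stokes_left]
  ring

/-- In the difference of the two equations, projected onto the low modes, the parameters enter only
through `α² - β²`. -/
lemma ae_updateField_eq (hab : a ≤ b) (hu : IsBardinaSolution L ν α f a b u)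
    (hw : IsNudgedSolution L ν β η N f u a b w) :
    ∀ᵐ s ∂volume.restrict (Set.Icc a b), updateField L ν β η N u w s
      = (α ^ 2 - β ^ 2) • stokes L (resid L ν N u s)
        - proj N (bilin L (w s - proj N (w s - u s)) (w s - proj N (w s - u s))
          - bilin L (u s) (u s)) := by
  filter_upwards [hu.eqn, hw.eqn, hu.regular.ae_timeDeriv_helm hab α,
    hw.regular.ae_timeDeriv_helm hab β, hu.regular.ae_timeDeriv_proj_sub hw.regular hab N,
    ae_restrict_mem measurableSet_Icc] with s hus hws hdu hdw hdg hs
  rw [hdu] at hus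
  rw [hdw, leray_of_mem (VSpace.sub (VSpace.proj (s' := 1) N (hw.regular.mem_V s hs))
    (VSpace.proj N (hu.regular.mem_V s hs)))] at hws
  rw [updateField, hdg]
  funext K
  by_cases hK : K ∈ lowModes N
  · have husK := congrFun hus K
    have hwsK := congrFun hws K
    simp only [helm, stokes, resid, Pi.add_apply, Pi.sub_apply, Pi.smul_apply,
      proj_apply_of_mem hK] at husK hwsK ⊢
    linear_combination (norm := module) hwsK - husK
  · simp only [helm, stokes, resid, Pi.add_apply, Pi.sub_apply, Pi.smul_apply,
      proj_apply_of_notMem hK]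
    simp

/-- The four terms of the error representation, paired with the field `r`. -/
def errorTerms (L : ℝ) (N : ℕ) (u w r : Coeff) : ℝ :=
  sInner L 0 (proj N (bilin L ((w - u) - proj N (w - u)) w)) r
    + sInner L 0 (proj N (bilin L w ((w - u) - proj N (w - u)))) r
    + sInner L 0 (proj N (bilin L (proj N (w - u) - (w - u)) (proj N (w - u)))) r
    + sInner L 0 (proj N (bilin L (w - u) (proj N (w - u) - (w - u)))) r

lemma errorTerms_eq {u w r : Coeff} (L : ℝ) (hu : u ∈ VSpace 1) (hw : w ∈ VSpace 1)
    (hr : ∀ K ∉ lowModes N, r K = 0) :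
    errorTerms L N u w r = sInner L 0
      (bilin L (w - proj N (w - u)) (w - proj N (w - u)) - bilin L u u) r := by
  rw [← bilin_splitting L hu hw (VSpace.proj N (VSpace.sub hw hu)), errorTerms]
  simp only [sInner_proj_left hr, sInner_add_left hr]

lemma ae_sInner_updateField_eq (hL : 0 < L) (hab : a ≤ b) (hu : IsBardinaSolution L ν α f a b u)
    (hw : IsNudgedSolution L ν β η N f u a b w) :
    ∀ᵐ s ∂volume.restrict (Set.Icc a b),
      sInner L 0 (updateField L ν β η N u w s) (resid L ν N u s)
        = (α ^ 2 - β ^ 2) * sNorm L 1 (resid L ν N u s) ^ 2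
          - errorTerms L N (u s) (w s) (resid L ν N u s) := by
  filter_upwards [ae_updateField_eq hab hu hw, ae_restrict_mem measurableSet_Icc] with s hs hsab
  have hr : ∀ K ∉ lowModes N, resid L ν N u s K = 0 := fun K hK => resid_apply_of_notMem hK s
  rw [hs, errorTerms_eq L (hu.regular.mem_V s hsab) (hw.regular.mem_V s hsab) hr,
    sInner_sub_left hr, sInner_smul_left hr, sInner_proj_left hr, sInner_stokes_left,
    sInner_self hL]

lemma sub_updatedBetaSq_eq {τ T : ℝ} (hL : 0 < L) (hτT : τ ≤ T)
    (hu : IsBardinaSolution L ν α f τ T u) (hw : IsNudgedSolution L ν β η N f u τ T w)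
    (hδ : delta L ν N u τ T ≠ 0)
    (herr : IntervalIntegrable (fun s => errorTerms L N (u s) (w s) (resid L ν N u s))
      volume τ T) :
    α ^ 2 - updatedBetaSq L ν β η N u w τ T
      = (delta L ν N u τ T)⁻¹ *
        ∫ s in τ..T, errorTerms L N (u s) (w s) (resid L ν N u s) := by
  have hint := intervalIntegral.intervalIntegrable_of_integral_ne_zero hδ
  have hbalance : ∫ s in τ..T, sInner L 0 (updateField L ν β η N u w s) (resid L ν N u s)
      = (α ^ 2 - β ^ 2) * delta L ν N u τ T
        - ∫ s in τ..T, errorTerms L N (u s) (w s) (resid L ν N u s) := by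
    rw [delta, ← intervalIntegral.integral_const_mul,
      ← intervalIntegral.integral_sub (hint.const_mul _) herr,
      intervalIntegral.integral_of_le hτT, intervalIntegral.integral_of_le hτT,
      restrict_Ioc_eq_restrict_Icc]
    exact integral_congr_ae (ae_sInner_updateField_eq hL hτT hu hw)
  rw [updatedBetaSq_eq, hbalance]
  field_simp
  ring

end Balance

/-! ### The error estimate -/

section Restriction

variable {L ν α β η a τ T : ℝ} {N : ℕ} {f u w : ℝ → Coeff}

lemma IsRegular.mono_left (h : IsRegular L a T u) (haτ : a ≤ τ) (hτT : τ ≤ T) :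
    IsRegular L τ T u := by
  have hsub : Set.Icc τ T ⊆ Set.Icc a T := Set.Icc_subset_Icc_left haτ
  have hτ : τ ∈ Set.Icc a T := ⟨haτ, hτT⟩
  have hint : ∀ K, ∀ t ∈ Set.Icc a T, IntervalIntegrable (fun s => timeDeriv u s K) volume τ t :=
    fun K t ht => (h.deriv_int K).mono_set (by
      rw [Set.uIcc_of_le (haτ.trans hτT)]
      exact Set.uIcc_subset_Icc hτ ht)
  refine ⟨fun t ht => h.mem_V t (hsub ht),
    fun t ht => (h.cont_V t (hsub ht)).mono_left (nhdsWithin_mono t hsub),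
    ae_restrict_of_ae_restrict_of_subset hsub h.mem_DA, h.sq_int_DA.mono_set hsub,
    fun K => hint K T ⟨haτ.trans hτT, le_rfl⟩, fun K t ht => ?_,
    ae_restrict_of_ae_restrict_of_subset hsub h.deriv_mem_H, h.sq_int_deriv.mono_set hsub⟩
  rw [h.ftc K t (hsub ht), h.ftc K τ hτ, add_assoc,
    intervalIntegral.integral_add_adjacent_intervals
      (hint K a ⟨le_rfl, haτ.trans hτT⟩).symm (hint K t (hsub ht))]

lemma IsBardinaSolution.mono_left (h : IsBardinaSolution L ν α f a T u) (haτ : a ≤ τ)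
    (hτT : τ ≤ T) : IsBardinaSolution L ν α f τ T u :=
  ⟨h.regular.mono_left haτ hτT,
    ae_restrict_of_ae_restrict_of_subset (Set.Icc_subset_Icc_left haτ) h.eqn⟩

lemma IsNudgedSolution.mono_left (h : IsNudgedSolution L ν β η N f u a T w) (haτ : a ≤ τ)
    (hτT : τ ≤ T) : IsNudgedSolution L ν β η N f u τ T w :=
  ⟨h.regular.mono_left haτ hτT,
    ae_restrict_of_ae_restrict_of_subset (Set.Icc_subset_Icc_left haτ) h.eqn⟩

end Restriction

/-- Each of the four terms has a factor `q = (w - u) - P_N (w - u)` or its negative; taking `q` in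
the norm `‖q‖^(1/2) ‖∇q‖^(1/2)` gains the power of `N`. -/
lemma abs_errorTerms_le {L c : ℝ} {N : ℕ} {u w r : Coeff} (hL : 0 < L)
    (hc : IsGagliardoNirenbergConst L c) (hN : 0 < N) (hu : u ∈ VSpace 1) (hw : w ∈ VSpace 1)
    (hr : r ∈ VSpace 1) (hS : ∀ K ∉ lowModes N, r K = 0) :
    |errorTerms L N u w r| ≤ 4 * c ^ 2 * lam1 L ^ (-(1 / 4) : ℝ) / (N : ℝ) ^ (1 / 2 : ℝ)
      * ((sNorm L 1 w + sNorm L 1 u) * sNorm L 1 (w - u)) * sNorm L 1 r := by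
  rw [errorTerms]
  simp only [sInner_proj_left hS]
  have hg : w - u ∈ VSpace 1 := VSpace.sub hw hu
  have hg_le : sNorm L 1 (w - u) ≤ sNorm L 1 w + sNorm L 1 u := sNorm_sub_le L hw hu
  generalize w - u = g at hg hg_le ⊢
  have hp : proj N g ∈ VSpace 1 := VSpace.proj N hg
  have hp_le : sNorm L 1 (proj N g) ≤ sNorm L 1 g := sNorm_mono hL hg (norm_proj_le N g)
  have hq := interpolation_sub_proj_le hL hN hg
  have hq' := hq
  rw [sNorm_sub_comm, sNorm_sub_comm L 1] at hq'
  rw [mul_div_assoc]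
  have hκ : 0 ≤ lam1 L ^ (-(1 / 4) : ℝ) / (N : ℝ) ^ (1 / 2 : ℝ) := by
    have := lam1_pos hL
    positivity
  generalize lam1 L ^ (-(1 / 4) : ℝ) / (N : ℝ) ^ (1 / 2 : ℝ) = κ at hq hq' hκ ⊢
  have term_le {x Q z : ℝ} (hx : |x| ≤ c ^ 2 * Q * z * sNorm L 1 r) (hQ : Q ≤ κ * sNorm L 1 g)
      (hz₀ : 0 ≤ z) (hz : z ≤ sNorm L 1 w + sNorm L 1 u) :
      |x| ≤ c ^ 2 * (κ * sNorm L 1 g) * (sNorm L 1 w + sNorm L 1 u) * sNorm L 1 r := by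
    have hg_nonneg := sNorm_nonneg L 1 g
    have hr_nonneg := sNorm_nonneg L 1 r
    exact hx.trans (by gcongr)
  have hw_nonneg := sNorm_nonneg L 1 w
  have hw_le : sNorm L 1 w ≤ sNorm L 1 w + sNorm L 1 u :=
    le_add_of_nonneg_right (sNorm_nonneg L 1 u)
  have h₁ := term_le (abs_sInner_bilin_le_left hL hc (VSpace.sub hg hp) hw hr hS) hq
    hw_nonneg hw_le
  have h₂ := term_le (abs_sInner_bilin_le_right hL hc hw (VSpace.sub hg hp) hr hS) hq
    hw_nonneg hw_le
  have h₃ := term_le (abs_sInner_bilin_le_left hL hc (VSpace.sub hp hg) hp hr hS) hq'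
    (sNorm_nonneg L 1 _) (hp_le.trans hg_le)
  have h₄ := term_le (abs_sInner_bilin_le_right hL hc hg (VSpace.sub hp hg) hr hS) hq'
    (sNorm_nonneg L 1 g) hg_le
  refine ((abs_add_le _ _).trans (add_le_add_left (abs_add_three _ _ _) _)).trans ?_
  linarith

section Integral

variable {X : Type*} [MeasurableSpace X] {μ : Measure X} [IsFiniteMeasure μ]

lemma integral_abs_le_sqrt_mul_sqrt {x : X → ℝ} (hx : MemLp x 2 μ) :
    ∫ t, |x t| ∂μ ≤ √(∫ t, x t ^ 2 ∂μ) * √(μ.real Set.univ) := by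
  have h := integral_mul_norm_le_Lp_mul_Lq (g := fun _ : X => (1 : ℝ)) (μ := μ)
    (Real.HolderConjugate.two_two) (by simpa using hx) (memLp_const 1)
  simpa [Real.sqrt_eq_rpow] using h

end Integral

section Error

variable {L ν c M τ T : ℝ} {N : ℕ} {u w : ℝ → Coeff}

lemma aemeasurable_errorTerms (hτT : τ ≤ T) (hu : IsRegular L τ T u) (hw : IsRegular L τ T w) :
    AEMeasurable (fun s => errorTerms L N (u s) (w s) (resid L ν N u s))
      (volume.restrict (Set.Icc τ T)) := by
  have huV : ∀ᵐ t ∂volume.restrict (Set.Icc τ T), u t ∈ VSpace 1 :=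
    (ae_restrict_mem measurableSet_Icc).mono hu.mem_V
  have hwV : ∀ᵐ t ∂volume.restrict (Set.Icc τ T), w t ∈ VSpace 1 :=
    (ae_restrict_mem measurableSet_Icc).mono hw.mem_V
  have hcorrV : ∀ᵐ t ∂volume.restrict (Set.Icc τ T), w t - proj N (w t - u t) ∈ VSpace 1 := by
    filter_upwards [huV, hwV] with t hut hwt
    exact VSpace.sub hwt (VSpace.proj N (VSpace.sub hwt hut))
  have mu := hu.aemeasurable hτT
  have mw := hw.aemeasurable hτT
  have mcorr : AEMeasurable (fun t => w t - proj N (w t - u t)) (volume.restrict (Set.Icc τ T)) :=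
    mw.sub ((measurable_proj N).comp_aemeasurable (mw.sub mu))
  have hS : ∀ t, ∀ K ∉ lowModes N, resid L ν N u t K = 0 :=
    fun t K hK => resid_apply_of_notMem hK t
  refine (aemeasurable_sInner ((aemeasurable_bilin L mcorr mcorr ?_ hcorrV).sub
    (aemeasurable_bilin L mu mu ?_ huV)) (hu.aemeasurable_resid hτT) hS L 0).congr ?_
  · exact hcorrV.mono fun t => VSpace.mono zero_le_one
  · exact huV.mono fun t => VSpace.mono zero_le_one
  · filter_upwards [huV, hwV] with t hut hwt
    exact (errorTerms_eq L hut hwt (hS t)).symm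

lemma pos_of_delta_ne_zero (hδ : delta L ν N u τ T ≠ 0) : 0 < N := by
  refine Nat.pos_of_ne_zero ?_
  rintro rfl
  have hresid (s : ℝ) : resid L ν 0 u s = 0 := by
    funext K
    exact resid_apply_of_notMem (fun hK =>
      (normSq_nonneg K).not_gt (by simpa using (mem_lowModes.1 hK).2)) s
  simp [delta, hresid, sNorm] at hδ

lemma memLp_sNorm_resid (hτT : τ ≤ T) (hδ : delta L ν N u τ T ≠ 0) :
    MemLp (fun s => sNorm L 1 (resid L ν N u s)) 2 (volume.restrict (Set.Icc τ T)) := by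
  have hint := intervalIntegral.intervalIntegrable_of_integral_ne_zero hδ
  rw [intervalIntegrable_iff_integrableOn_Icc_of_le hτT] at hint
  have hmeas := Real.continuous_sqrt.comp_aestronglyMeasurable hint.aestronglyMeasurable
  simp only [Real.sqrt_sq (sNorm_nonneg _ _ _)] at hmeas
  exact (memLp_two_iff_integrable_sq hmeas).2 hint

lemma integral_sNorm_resid_le (hτT : τ ≤ T) (hδ : delta L ν N u τ T ≠ 0) :
    ∫ s in τ..T, sNorm L 1 (resid L ν N u s) ≤ √(delta L ν N u τ T) * √(T - τ) := by
  have h := integral_abs_le_sqrt_mul_sqrt (memLp_sNorm_resid hτT hδ)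
  simp only [abs_of_nonneg (sNorm_nonneg _ _ _), measureReal_restrict_apply_univ,
    Real.volume_real_Icc_of_le hτT] at h
  rwa [delta, intervalIntegral.integral_of_le hτT, intervalIntegral.integral_of_le hτT,
    restrict_Ioc_eq_restrict_Icc]

lemma bddAbove_image_sNorm_mul (hu : IsRegular L τ T u) (hw : IsRegular L τ T w) :
    BddAbove ((fun s => (sNorm L 1 (w s) + sNorm L 1 (u s)) * sNorm L 1 (w s - u s)) ''
      Set.Icc τ T) := by
  obtain ⟨C, hC⟩ := isCompact_Icc.bddAbove_image
    ((hw.continuousOn_sNorm.add hu.continuousOn_sNorm).pow 2)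
  refine ⟨C, Set.forall_mem_image.2 fun s hs => le_trans ?_ (hC (Set.mem_image_of_mem _ hs))⟩
  rw [sq]
  exact mul_le_mul_of_nonneg_left (sNorm_sub_le L (hw.mem_V s hs) (hu.mem_V s hs))
    (add_nonneg (sNorm_nonneg L 1 _) (sNorm_nonneg L 1 _))

lemma ae_abs_errorTerms_le (hL : 0 < L) (hc : IsGagliardoNirenbergConst L c) (hN : 0 < N)
    (hu : IsRegular L τ T u) (hw : IsRegular L τ T w)
    (hM : ∀ s ∈ Set.Icc τ T, (sNorm L 1 (w s) + sNorm L 1 (u s)) * sNorm L 1 (w s - u s) ≤ M) :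
    ∀ᵐ s ∂volume.restrict (Set.Icc τ T), |errorTerms L N (u s) (w s) (resid L ν N u s)|
      ≤ 4 * c ^ 2 * lam1 L ^ (-(1 / 4) : ℝ) / (N : ℝ) ^ (1 / 2 : ℝ) * M
        * sNorm L 1 (resid L ν N u s) := by
  have hl := lam1_pos hL
  filter_upwards [hu.ae_resid_mem 1, ae_restrict_mem measurableSet_Icc] with s hr hs
  refine (abs_errorTerms_le hL hc hN (hu.mem_V s hs) (hw.mem_V s hs) hr
    fun K hK => resid_apply_of_notMem hK s).trans ?_
  have := sNorm_nonneg L 1 (resid L ν N u s)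
  have := hM s hs
  gcongr

lemma intervalIntegrable_errorTerms (hL : 0 < L) (hc : IsGagliardoNirenbergConst L c)
    (hτT : τ ≤ T) (hu : IsRegular L τ T u) (hw : IsRegular L τ T w)
    (hδ : delta L ν N u τ T ≠ 0) :
    IntervalIntegrable (fun s => errorTerms L N (u s) (w s) (resid L ν N u s)) volume τ T := by
  rw [intervalIntegrable_iff_integrableOn_Icc_of_le hτT]
  exact (((memLp_sNorm_resid hτT hδ).integrable one_le_two).const_mul _).mono'
    (aemeasurable_errorTerms hτT hu hw).aestronglyMeasurable
    (ae_abs_errorTerms_le hL hc (pos_of_delta_ne_zero hδ) hu hw fun _ hs =>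
      le_csSup (bddAbove_image_sNorm_mul hu hw) (Set.mem_image_of_mem _ hs))

lemma abs_integral_errorTerms_le (hL : 0 < L) (hc : IsGagliardoNirenbergConst L c)
    (hτT : τ ≤ T) (hu : IsRegular L τ T u) (hw : IsRegular L τ T w)
    (hδ : delta L ν N u τ T ≠ 0) :
    |∫ s in τ..T, errorTerms L N (u s) (w s) (resid L ν N u s)|
      ≤ 4 * c ^ 2 * lam1 L ^ (-(1 / 4) : ℝ) / (N : ℝ) ^ (1 / 2 : ℝ)
        * sSup ((fun s => (sNorm L 1 (w s) + sNorm L 1 (u s)) * sNorm L 1 (w s - u s)) ''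
            Set.Icc τ T)
        * (√(delta L ν N u τ T) * √(T - τ)) := by
  have hl := lam1_pos hL
  set Φ := fun s => (sNorm L 1 (w s) + sNorm L 1 (u s)) * sNorm L 1 (w s - u s)
  have hbound := ae_abs_errorTerms_le (ν := ν) hL hc (pos_of_delta_ne_zero hδ) hu hw
    fun _ hs => le_csSup (bddAbove_image_sNorm_mul hu hw) (Set.mem_image_of_mem Φ hs)
  have hsup : 0 ≤ sSup (Φ '' Set.Icc τ T) :=
    Real.sSup_nonneg (Set.forall_mem_image.2 fun s _ =>
      mul_nonneg (add_nonneg (sNorm_nonneg _ _ _) (sNorm_nonneg _ _ _)) (sNorm_nonneg _ _ _))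
  rw [← restrict_Ioc_eq_restrict_Icc, ae_restrict_iff' measurableSet_Ioc] at hbound
  have hint : IntervalIntegrable (fun s => sNorm L 1 (resid L ν N u s)) volume τ T :=
    (intervalIntegrable_iff_integrableOn_Icc_of_le hτT).2
      ((memLp_sNorm_resid hτT hδ).integrable one_le_two)
  simp only [← Real.norm_eq_abs] at hbound ⊢
  refine (intervalIntegral.norm_integral_le_of_norm_le hτT hbound (hint.const_mul _)).trans ?_
  rw [intervalIntegral.integral_const_mul]
  gcongr
  exact integral_sNorm_resid_le hτT hδ

end Error

end Bardina

end

theorem proposition5p6_general {L ν α β η c τ T : ℝ} {N : ℕ} {f u w : ℝ → Coeff} (hL : 0 < L)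
    (hc : IsGagliardoNirenbergConst L c) (hτT : τ < T) (hu : IsBardinaSolution L ν α f τ T u)
    (hw : IsNudgedSolution L ν β η N f u τ T w) (hδ : 0 < delta L ν N u τ T) :
    |α ^ 2 - updatedBetaSq L ν β η N u w τ T| ≤
      4 * c ^ 2 * lam1 L ^ (-(1 / 4) : ℝ)
        / ((delta L ν N u τ T / (T - τ)) ^ (1 / 2 : ℝ) * (N : ℝ) ^ (1 / 2 : ℝ))
        * sSup ((fun s => (sNorm L 1 (w s) + sNorm L 1 (u s)) * sNorm L 1 (w s - u s)) ''
            Set.Icc τ T) ∧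
    α ^ 2 - updatedBetaSq L ν β η N u w τ T =
      (delta L ν N u τ T)⁻¹ * ∫ s in τ..T, errorTerms L N (u s) (w s) (resid L ν N u s) := by
  have hrep := sub_updatedBetaSq_eq hL hτT.le hu hw hδ.ne'
    (intervalIntegrable_errorTerms hL hc hτT.le hu.regular hw.regular hδ.ne')
  refine ⟨?_, hrep⟩
  have hT : 0 < T - τ := sub_pos.2 hτT
  have hN : (0 : ℝ) < N := Nat.cast_pos.2 (pos_of_delta_ne_zero hδ.ne')
  rw [hrep, abs_mul, abs_of_pos (inv_pos.2 hδ)]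
  refine (mul_le_mul_of_nonneg_left
    (abs_integral_errorTerms_le hL hc hτT.le hu.regular hw.regular hδ.ne')
    (inv_pos.2 hδ).le).trans_eq ?_
  rw [← Real.sqrt_eq_rpow (delta L ν N u τ T / (T - τ)), Real.sqrt_div hδ.le]
  field_simp
  rw [Real.sq_sqrt hδ.le]
  ring

theorem proposition5p6
    (L ν α β η c : ℝ) (N : ℕ) (hL : 0 < L) (hν : 0 < ν) (hα : 0 < α) (hβ : 0 < β) (hη : 0 < η)
    (hc : IsGagliardoNirenbergConst L c)
    (f : ℝ → Coeff) (hf : IsForcing L f)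
    (a τ T : ℝ) (ha : 0 ≤ a) (haτ : a ≤ τ) (hτT : τ < T)
    (u w : ℝ → Coeff)
    (hu : IsBardinaSolution L ν α f a T u)
    (hw : IsNudgedSolution L ν β η N f u a T w)
    (hδ : 0 < delta L ν N u τ T) :
    |α ^ 2 - updatedBetaSq L ν β η N u w τ T| ≤
      4 * c ^ 2 * lam1 L ^ (-(1 / 4) : ℝ)
        / ((delta L ν N u τ T / (T - τ)) ^ (1 / 2 : ℝ) * (N : ℝ) ^ (1 / 2 : ℝ))
        * sSup ((fun s => (sNorm L 1 (w s) + sNorm L 1 (u s)) * sNorm L 1 (w s - u s)) ''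
            Set.Icc τ T) ∧
    α ^ 2 - updatedBetaSq L ν β η N u w τ T =
      (delta L ν N u τ T)⁻¹ * ∫ s in τ..T,
        (sInner L 0 (proj N (bilin L ((w s - u s) - proj N (w s - u s)) (w s)))
            (resid L ν N u s)
          + sInner L 0 (proj N (bilin L (w s) ((w s - u s) - proj N (w s - u s))))
            (resid L ν N u s)
          + sInner L 0 (proj N (bilin L (proj N (w s - u s) - (w s - u s)) (proj N (w s - u s))))
            (resid L ν N u s)
          + sInner L 0 (proj N (bilin L (w s - u s) (proj N (w s - u s) - (w s - u s))))
            (resid L ν N u s)) :=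
  proposition5p6_general hL hc hτT (hu.mono_left haτ hτT.le) (hw.mono_left haτ hτT.le) hδ
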